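/- Let $M$ be a closed (compact, connected, boundaryless) smooth surface with a smooth Riemannian metric, and let $f:M\to M$ be a $C^1$ map (an endomorphism, possibly with critical points) which is transitive, i.e. has a dense forward orbit. Suppose that $f$ admits a dominated splitting, exhibited by a continuous cone field $\mathscr{C}$ on $M$: each $\mathscr{C}(x)\subseteq T_xM$ is a closed convex cone $K(x)\neq\{0\}$ containing no line, or the two-sided cone $K(x)\cup -K(x)$ spanned by such a cone; $\mathscr{C}(x)$ depends continuously on $x$; there is $k\ge 1$ with $Df^k_x(\mathscr{C}(x))\subseteq \mathrm{int}\,\mathscr{C}(f^k(x))\cup\{0\}$ for all $x\in M$; and $\ker(Df^n_x)\cap\mathscr{C}(x)=\{0\}$ for all $x\in M$ and $n\ge 1$. A u-arc is an injective Lipschitz curve $\gamma:[0,1]\to M$ all of whose tangent vectors lie in $\mathscr{C}$; here a tangent vector of $\gamma$ at $t$ is any limit, in a chart at $\gamma(t)$, of $c_i\,\frac{\gamma(s_i)-\gamma(t)}{s_i-t}$ with $s_i\to t$, $s_i\ne t$ and $c_i\ge 0$. Write $\ell(f^n(\gamma))$ for the length of the curve $f^n\circ\gamma$. Then the length of the forward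 iterates of every u-arc grows exponentially: there is $r>1$ such that for every u-arc $\gamma$ there is $c>0$ with $$\ell(f^n(\gamma))\ \ge\ c\,r^n\qquad\text{for all } n\ge 0 .$$ -/

import Mathlib

open Set Filter Function Topology Bundle
open scoped Manifold ContDiff ENNReal

/-- A map is (topologically) transitive if some forward orbit is dense. -/
def IsTransitiveMap {M : Type*} [TopologicalSpace M] (f : M → M) : Prop :=
  ∃ x : M, Dense (range fun n : ℕ => f^[n] x)

/-- `K` is a closed convex cone with apex `0`, not reduced to `0`, which contains no line. -/
structure IsClosedConvexCone {V : Type*} [AddCommGroup V] [Module ℝ V] [TopologicalSpace V]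
    (K : Set V) : Prop where
  isClosed : IsClosed K
  convex : Convex ℝ K
  smul_mem : ∀ c : ℝ, 0 ≤ c → ∀ v ∈ K, c • v ∈ K
  nontrivial : ∃ v ∈ K, v ≠ 0
  salient : ∀ v ∈ K, -v ∈ K → v = 0

/-- A cone is a closed convex cone `K`, or the two-sided cone `K ∪ -K` which it spans
(such as `{u₁ + u₂ ∈ L ⊕ Lᗮ : ‖u₂‖ ≤ η ‖u₁‖}` for a line `L`). -/
def IsCone {V : Type*} [AddCommGroup V] [Module ℝ V] [TopologicalSpace V] (S : Set V) : Prop :=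
  ∃ K : Set V, IsClosedConvexCone K ∧ (S = K ∨ S = {v | v ∈ K ∨ -v ∈ K})

section Surface

variable {M : Type*} [TopologicalSpace M] [ChartedSpace (EuclideanSpace ℝ (Fin 2)) M]

/-- A continuous cone field on the surface `M`: a cone in each tangent space, varying continuously
with the point, in the sense that limits of cone vectors are cone vectors (`isClosed`), and that
every cone vector at `x` is approximated by cone vectors at all points near `x` (`isOpen`). For
cones this is continuity in the Hausdorff distance of their sets of unit vectors. -/
structure IsContinuousConeField [IsManifold (𝓡 2) 1 M]
    (C : ∀ x : M, Set (TangentSpace (𝓡 2) x)) : Prop where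
  isCone : ∀ x, IsCone (C x)
  isClosed : IsClosed {p : TangentBundle (𝓡 2) M | p.2 ∈ C p.1}
  isOpen : ∀ U : Set (TangentBundle (𝓡 2) M), IsOpen U →
    IsOpen {x : M | ∃ v ∈ C x, (⟨x, v⟩ : TangentBundle (𝓡 2) M) ∈ U}

/-- The cone field `C` is invariant: for some `k ≥ 1`, the derivative of `f^k` maps each cone
into the interior of the cone at the image point (the apex being counted in the interior). -/
def IsInvariantConeField (f : M → M) (C : ∀ x : M, Set (TangentSpace (𝓡 2) x)) : Prop :=
  ∃ k : ℕ, 1 ≤ k ∧ ∀ x : M, ∀ v ∈ C x,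
    mfderiv (𝓡 2) (𝓡 2) f^[k] x v ∈ insert 0 (interior (C (f^[k] x)))

/-- The cone field `C` is transversal to the kernels of the derivatives of all the iterates. -/
def IsTransversalToKernel (f : M → M) (C : ∀ x : M, Set (TangentSpace (𝓡 2) x)) : Prop :=
  ∀ x : M, ∀ n : ℕ, 1 ≤ n → ∀ v ∈ C x, mfderiv (𝓡 2) (𝓡 2) f^[n] x v = 0 → v = 0

/-- The continuous cone field `C` exhibits a dominated splitting for `f`. -/
structure IsDominatedSplitting [IsManifold (𝓡 2) 1 M]
    (f : M → M) (C : ∀ x : M, Set (TangentSpace (𝓡 2) x)) : Prop where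
  isContinuousConeField : IsContinuousConeField C
  invariant : IsInvariantConeField f C
  transversal : IsTransversalToKernel f C

/-- `v` is a tangent vector at time `t` to the curve `γ : [0,1] → M`: in the preferred chart at
`γ t` (which is the one that identifies `T_{γ t} M` with `ℝ²`), `v` is a limit of nonnegative
multiples of difference quotients of `γ` at times `s i → t`. If `γ` is differentiable at `t` with
derivative `w ≠ 0`, these are the nonnegative multiples of `w`. -/
def IsTangentVector (γ : ℝ → M) (t : ℝ) (v : TangentSpace (𝓡 2) (γ t)) : Prop :=
  ∃ s c : ℕ → ℝ, (∀ i, s i ∈ Icc (0 : ℝ) 1 ∧ s i ≠ t ∧ 0 ≤ c i) ∧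
    Tendsto s atTop (𝓝 t) ∧
    Tendsto (fun i => (c i / (s i - t)) •
      (extChartAt (𝓡 2) (γ t) (γ (s i)) - extChartAt (𝓡 2) (γ t) (γ t)))
      atTop (𝓝 (v : EuclideanSpace ℝ (Fin 2)))

end Surface

/-- A u-arc: an injective Lipschitz curve `[0,1] → M` (given by a function on `ℝ`, of which only
the restriction to `[0,1]` is used) all of whose tangent vectors lie in the cone field `C`. -/
structure IsUArc {M : Type*} [PseudoEMetricSpace M] [ChartedSpace (EuclideanSpace ℝ (Fin 2)) M]
    (C : ∀ x : M, Set (TangentSpace (𝓡 2) x)) (γ : ℝ → M) : Prop where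
  injOn : InjOn γ (Icc 0 1)
  lipschitz : ∃ K, LipschitzOnWith K γ (Icc 0 1)
  tangent : ∀ t ∈ Icc (0 : ℝ) 1, ∀ v : TangentSpace (𝓡 2) (γ t),
    IsTangentVector γ t v → v ∈ C (γ t)

/-- The length of a curve parametrized by `[0,1]`: the supremum of the lengths of inscribed
polygons. -/
noncomputable def arcLength {M : Type*} [PseudoEMetricSpace M] (γ : ℝ → M) : ℝ≥0∞ :=
  eVariationOn γ (Icc 0 1)

/-!
# Exponential growth of u-arcs of transitive surface endomorphisms with dominated splitting

Let `F = f^k` be the iterate which maps the cone field strictly into itself. In suitable charts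
(`IsConeAtlas`, constructed in `exists_finite_adapted_atlas`) the derivative of `F` maps the
constant cone `|y| ≤ |x|` into the narrower cone `|y| ≤ θ |x|`, `θ < 1`. By Cauchy's mean value
theorem `F` is then locally monotone for the order of the plane defined by the cone
(`exists_monotone_of_mapsConeInto`). Consequently, as long as the iterates of two ordered points
`a`, `b` stay close, the iterates of the whole order interval between them are caught between those
of `a` and `b` (`IsConeAtlas.exists_mapsTo_iterate_orderInterval`); and this order interval contains
a ball.

Transitivity enters through sensitivity to initial conditions (`IsConeAtlas.isSensitive`). If a
transitive map is not sensitive, then points with dense orbit are points of equicontinuity, and some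
iterates `f^m` are uniformly close to the identity. But `F^m` maps a short chord of slope `1` to a
chord of slope at most `θ`, so it does not come arbitrarily close to the identity.

By sensitivity, the order interval of two ordered points cannot stay small under iteration, hence
neither can the distance of the two points; by compactness the time needed to separate to a fixed
distance is bounded in terms of the initial distance (`IsConeAtlas.exists_separation_time`). An
ordered arc of diameter `δ` thus contains, after a bounded time, two consecutive ordered arcs of
diameter `δ`, and its length doubles in bounded time (`IsConeAtlas.exists_doubling`).

Finally, every u-arc contains an ordered arc (`IsUArc.exists_isOrderedArc`). This is not automatic
for two-sided cones, as a u-arc may turn back; the chords issued from each of its points are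
eventually in the cone, and Baire's theorem gives an interval on which this holds uniformly.
-/

/-! ### Sensitivity of transitive maps -/

section Sensitivity

variable {X : Type*} [MetricSpace X]

/-- Sensitive dependence on initial conditions: some scale `ε` is reached by the iterates of every
nonempty open set. -/
def IsSensitive (f : X → X) : Prop :=
  ∃ ε > 0, ∀ U : Set X, IsOpen U → U.Nonempty →
    ∃ n : ℕ, ∃ x ∈ U, ∃ y ∈ U, ε ≤ dist (f^[n] x) (f^[n] y)

lemma exists_modulus_iterate [CompactSpace X] {f : X → X} (hf : Continuous f) (N : ℕ) {ε : ℝ}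
    (hε : 0 < ε) :
    ∃ δ > 0, ∀ n ≤ N, ∀ x y, dist x y < δ → dist (f^[n] x) (f^[n] y) < ε := by
  induction N with
  | zero =>
    refine ⟨ε, hε, fun n hn x y h => ?_⟩
    obtain rfl : n = 0 := by omega
    simpa using h
  | succ N ih =>
    obtain ⟨δ, hδ, h⟩ := ih
    obtain ⟨δ', hδ', h'⟩ := Metric.uniformContinuous_iff.1
      (CompactSpace.uniformContinuous_of_continuous (hf.iterate (N + 1))) ε hε
    refine ⟨min δ δ', lt_min hδ hδ', fun n hn x y hxy => ?_⟩
    rcases Nat.lt_or_ge n (N + 1) with h1 | h1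
    · exact h n (by omega) x y (hxy.trans_le (min_le_left _ _))
    · obtain rfl : n = N + 1 := by omega
      exact h' (hxy.trans_le (min_le_right _ _))

/-- Sensitivity passes from a map to its powers, since the intermediate iterates are uniformly
continuous. -/
lemma IsSensitive.iterate [CompactSpace X] {f : X → X} (hf : Continuous f) (h : IsSensitive f)
    {k : ℕ} (hk : 1 ≤ k) : IsSensitive f^[k] := by
  obtain ⟨ε, hε, h⟩ := h
  obtain ⟨δ, hδ, hmod⟩ := exists_modulus_iterate hf k hε
  refine ⟨δ, hδ, fun U hU hne => ?_⟩
  obtain ⟨n, x, hx, y, hy, hxy⟩ := h U hU hne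
  refine ⟨n / k, x, hx, y, hy, ?_⟩
  by_contra! hlt
  refine absurd (hmod (n % k) (Nat.mod_lt _ hk).le _ _ hlt) (not_lt.2 ?_)
  rwa [← iterate_mul, ← iterate_add_apply, ← iterate_add_apply, Nat.mod_add_div]

/-- In a transitive system which is not sensitive, a point `x₀` with dense orbit is a point of
equicontinuity. -/
lemma equicontinuous_of_not_isSensitive [CompactSpace X] {f : X → X} (hf : Continuous f) {x₀ : X}
    (hx₀ : Dense (range fun n : ℕ => f^[n] x₀)) (hns : ¬ IsSensitive f) {ε : ℝ} (hε : 0 < ε) :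
    ∃ δ > 0, ∀ x y, dist x x₀ < δ → dist y x₀ < δ → ∀ n : ℕ, dist (f^[n] x) (f^[n] y) < ε := by
  simp only [IsSensitive, not_exists, not_and, not_forall, not_le] at hns
  obtain ⟨U, hU, hne, h⟩ := hns ε hε
  obtain ⟨_, hm, m, rfl⟩ := hx₀.inter_open_nonempty U hU hne
  obtain ⟨δ, hδ, hball⟩ := Metric.isOpen_iff.1 (hU.preimage (hf.iterate m)) x₀ hm
  obtain ⟨δ', hδ', hmod⟩ := exists_modulus_iterate hf m hε
  refine ⟨min δ (δ' / 2), lt_min hδ (half_pos hδ'), fun x y hx hy n => ?_⟩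
  rcases le_total n m with hn | hn
  · refine hmod n hn _ _ ((dist_triangle_right x y x₀).trans_lt ?_)
    linarith [hx.trans_le (min_le_right _ _), hy.trans_le (min_le_right _ _)]
  · obtain ⟨j, rfl⟩ := Nat.exists_eq_add_of_le' hn
    rw [iterate_add_apply, iterate_add_apply]
    exact h j _ (hball (hx.trans_le (min_le_left _ _))) _ (hball (hy.trans_le (min_le_left _ _)))

/-- In a transitive system which is not sensitive, some iterates are uniformly close to the
identity: if `f^m x₀` is close to the equicontinuity point `x₀`, then `f^(n+m) x₀` is close to
`f^n x₀` for all `n`, and the points `f^n x₀` are dense. -/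
lemma exists_iterate_near_id_of_not_isSensitive [CompactSpace X] {f : X → X} (hf : Continuous f)
    {x₀ : X} [(𝓝[≠] x₀).NeBot] (hx₀ : Dense (range fun n : ℕ => f^[n] x₀))
    (hns : ¬ IsSensitive f) {ε : ℝ} (hε : 0 < ε) :
    ∃ m : ℕ, 1 ≤ m ∧ ∀ y, dist (f^[m] y) y ≤ ε := by
  obtain ⟨δ, hδ, h⟩ := equicontinuous_of_not_isSensitive hf hx₀ hns hε
  -- the orbit meets the punctured ball around `x₀`, which is open and nonempty
  obtain ⟨_, ⟨hm, hm'⟩, m, rfl⟩ := hx₀.inter_open_nonempty (Metric.ball x₀ δ ∩ {x₀}ᶜ)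
    (Metric.isOpen_ball.inter isOpen_compl_singleton) (by
      obtain ⟨y, hy⟩ := ((inferInstance : (𝓝[≠] x₀).NeBot)).nonempty_of_mem
        (inter_mem (mem_nhdsWithin_of_mem_nhds (Metric.ball_mem_nhds x₀ hδ)) self_mem_nhdsWithin)
      exact ⟨y, hy⟩)
  refine ⟨m, ?_, fun y => ?_⟩
  · rcases Nat.eq_zero_or_pos m with rfl | h0
    · simp at hm'
    · exact h0
  · have hcl : IsClosed {y : X | dist (f^[m] y) y ≤ ε} :=
      isClosed_le ((hf.iterate m).dist continuous_id) continuous_const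
    refine hcl.closure_subset_iff.2 ?_ (hx₀ y)
    rintro _ ⟨n, rfl⟩
    have := h (f^[m] x₀) x₀ hm (by simpa using hδ) n
    change dist (f^[m] (f^[n] x₀)) (f^[n] x₀) ≤ ε
    rw [← iterate_add_apply, add_comm, iterate_add_apply]
    exact this.le

lemma exists_pow_near_id {f : X → X} {m : ℕ} {ε : ℝ} (h : ∀ y, dist (f^[m] y) y ≤ ε) (k : ℕ)
    (y : X) : dist ((f^[k])^[m] y) y ≤ k * ε := by
  rw [← iterate_mul, mul_comm, iterate_mul]
  induction k with
  | zero => simp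
  | succ k ih =>
    rw [iterate_succ_apply']
    push_cast
    linarith [dist_triangle (f^[m] ((f^[m])^[k] y)) ((f^[m])^[k] y) y, h ((f^[m])^[k] y)]

/-- For a sensitive map of a compact space, balls of a given radius separate within a uniformly
bounded time. -/
lemma exists_uniform_separation_time [CompactSpace X] {f : X → X} {ε : ℝ}
    (h : ∀ U : Set X, IsOpen U → U.Nonempty →
      ∃ n : ℕ, ∃ x ∈ U, ∃ y ∈ U, ε ≤ dist (f^[n] x) (f^[n] y)) {ρ : ℝ} (hρ : 0 < ρ) :
    ∃ N : ℕ, ∀ z, ∃ n ≤ N, ∃ x ∈ Metric.ball z ρ, ∃ y ∈ Metric.ball z ρ,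
      ε ≤ dist (f^[n] x) (f^[n] y) := by
  obtain ⟨t, -, ht, hcov⟩ := (isCompact_univ (X := X)).finite_cover_balls
    (half_pos hρ)
  choose n x hx y hy hxy using fun z : X =>
    h (Metric.ball z (ρ / 2)) Metric.isOpen_ball ⟨z, Metric.mem_ball_self (half_pos hρ)⟩
  obtain ⟨N, hN⟩ := (ht.image n).bddAbove
  refine ⟨N, fun z => ?_⟩
  obtain ⟨w, hw, hz⟩ := mem_iUnion₂.1 (hcov (mem_univ z))
  have hsub : Metric.ball w (ρ / 2) ⊆ Metric.ball z ρ := fun p hp => by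
    simp only [Metric.mem_ball] at hp hz ⊢
    linarith [dist_triangle_right p z w]
  exact ⟨n w, hN (mem_image_of_mem n hw), x w, hsub (hx w), y w, hsub (hy w), hxy w⟩

end Sensitivity

/-! ### The cone order of the plane and locally monotone maps -/

section ConeOrder

/-- The order of the plane given by the horizontal cone of slope `θ`, pointing to the right for
`σ = 1` and to the left for `σ = -1`. -/
def ConeLE (θ σ : ℝ) (a b : ℝ × ℝ) : Prop :=
  |b.2 - a.2| ≤ θ * (σ * (b.1 - a.1))

/-- The order interval between `a` and `b` for the cone of slope `1`. -/
def coneInterval (σ : ℝ) (a b : ℝ × ℝ) : Set (ℝ × ℝ) :=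
  {z | ConeLE 1 σ a z ∧ ConeLE 1 σ z b}

variable {θ σ : ℝ} {a b p q z : ℝ × ℝ}

lemma ConeLE.refl (θ σ : ℝ) (a : ℝ × ℝ) : ConeLE θ σ a a := by simp [ConeLE]

lemma ConeLE.nonneg (h : ConeLE θ σ a b) (hθ : 0 < θ) : 0 ≤ σ * (b.1 - a.1) :=
  nonneg_of_mul_nonneg_right ((abs_nonneg _).trans h) hθ

lemma ConeLE.mono (h : ConeLE θ σ a b) (hθ : 0 < θ) (hθ1 : θ ≤ 1) : ConeLE 1 σ a b :=
  h.trans (mul_le_mul_of_nonneg_right hθ1 (h.nonneg hθ))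

lemma ConeLE.abs_le (h : ConeLE θ σ a b) (hθ : 0 < θ) (hσ : σ = 1 ∨ σ = -1) :
    |b.2 - a.2| ≤ θ * |b.1 - a.1| := by
  refine h.trans (mul_le_mul_of_nonneg_left ?_ hθ.le)
  rcases hσ with rfl | rfl
  · simpa using le_abs_self (b.1 - a.1)
  · simpa using neg_le_abs (b.1 - a.1)

lemma ConeLE.norm_sub (h : ConeLE 1 σ a b) (hσ : σ = 1 ∨ σ = -1) :
    ‖b - a‖ = σ * (b.1 - a.1) := by
  have h0 := h.nonneg one_pos
  have h1 : |b.1 - a.1| = σ * (b.1 - a.1) := by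
    rcases hσ with rfl | rfl
    · simpa using h0
    · rw [abs_of_nonpos (by linarith)]; ring
  rw [Prod.norm_def, Real.norm_eq_abs, Real.norm_eq_abs, Prod.fst_sub, Prod.snd_sub, h1]
  exact max_eq_left (by simpa [ConeLE] using h)

lemma ConeLE.norm_sub_le (h : ConeLE 1 σ a z) (h' : ConeLE 1 σ z b) (hσ : σ = 1 ∨ σ = -1) :
    ‖z - a‖ ≤ ‖b - a‖ := by
  have hab : ConeLE 1 σ a b := by
    unfold ConeLE at *
    have := abs_add_le (b.2 - z.2) (z.2 - a.2)
    rw [sub_add_sub_cancel] at this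
    linarith
  rw [h.norm_sub hσ, hab.norm_sub hσ]
  linarith [h'.nonneg one_pos]

lemma convex_coneInterval (σ : ℝ) (a b : ℝ × ℝ) : Convex ℝ (coneInterval σ a b) := by
  rintro z ⟨h1, h2⟩ w ⟨h3, h4⟩ s t hs ht hst
  simp only [coneInterval, ConeLE, mem_ofPred_eq, Prod.fst_add, Prod.snd_add, Prod.smul_fst,
    Prod.smul_snd, smul_eq_mul, abs_le, one_mul] at *
  obtain rfl : t = 1 - s := by linarith
  refine ⟨⟨?_, ?_⟩, ?_, ?_⟩ <;> nlinarith

lemma norm_lt_two_of_mem_coneInterval (hσ : σ = 1 ∨ σ = -1) (ha : ‖a‖ < 1) (hb : ‖b‖ < 1)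
    (hz : z ∈ coneInterval σ a b) : ‖z‖ < 2 := by
  obtain ⟨h1, h2⟩ := hz
  simp only [ConeLE, one_mul, Prod.norm_def, max_lt_iff, Real.norm_eq_abs, abs_le, abs_lt] at *
  rcases hσ with rfl | rfl <;> refine ⟨⟨?_, ?_⟩, ?_, ?_⟩ <;> linarith

/-- The order interval between two points in strict position contains a ball, of radius
proportional to the distance of the points. -/
lemma mem_coneInterval_of_near_midpoint (hσ : σ = 1 ∨ σ = -1)
    (h : ConeLE θ σ a b) (hθ : 0 < θ) (hθ1 : θ < 1)
    (hz : ‖z - midpoint ℝ a b‖ ≤ (1 - θ) / 4 * ‖b - a‖) : z ∈ coneInterval σ a b := by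
  have h1 := h.mono hθ hθ1.le
  rw [h1.norm_sub hσ] at hz
  have hx : (midpoint ℝ a b).1 = (a.1 + b.1) / 2 := by
    simp [midpoint_eq_smul_add]; ring
  have hy : (midpoint ℝ a b).2 = (a.2 + b.2) / 2 := by
    simp [midpoint_eq_smul_add]; ring
  simp only [coneInterval, ConeLE, one_mul, mem_ofPred_eq, Prod.norm_def, max_le_iff,
    Real.norm_eq_abs, Prod.fst_sub, Prod.snd_sub, hx, hy, abs_le] at *
  rcases hσ with rfl | rfl <;> refine ⟨⟨?_, ?_⟩, ?_, ?_⟩ <;> nlinarith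

/-- A linear map sends the horizontal two-sided cone of slope `1` strictly into that of
slope `θ`. -/
def MapsConeInto (θ : ℝ) (A : ℝ × ℝ →L[ℝ] ℝ × ℝ) : Prop :=
  ∀ v : ℝ × ℝ, v ≠ 0 → |v.2| ≤ |v.1| → |(A v).2| ≤ θ * |(A v).1| ∧ (A v).1 ≠ 0

/-- By Cauchy's mean value theorem, chords in the cone of slope `1` are mapped to chords in the
cone of slope `θ` if the derivative does so. -/
lemma chord_image_of_mapsConeInto {G : ℝ × ℝ → ℝ × ℝ} {Ω : Set (ℝ × ℝ)} (hΩ : Convex ℝ Ω)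
    (hG : ∀ z ∈ Ω, ∃ A, HasFDerivAt G A z ∧ MapsConeInto θ A) (hp : p ∈ Ω) (hq : q ∈ Ω)
    (hpq : q - p ≠ 0) (hcone : |(q - p).2| ≤ |(q - p).1|) :
    |(G q).2 - (G p).2| ≤ θ * |(G q).1 - (G p).1| ∧ (G q).1 - (G p).1 ≠ 0 := by
  let c : ℝ → ℝ × ℝ := fun t => p + t • (q - p)
  have hc : ∀ t ∈ Icc (0 : ℝ) 1, c t ∈ Ω := fun t ht => hΩ.add_smul_sub_mem hp hq ht
  choose! A hA hA' using hG
  have hcd : ∀ t, HasDerivAt c (q - p) t := fun t => by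
    have := ((hasDerivAt_id t).smul_const (q - p)).const_add p
    rwa [one_smul] at this
  have hd : ∀ t ∈ Icc (0 : ℝ) 1, HasDerivAt (G ∘ c) (A (c t) (q - p)) t := fun t ht =>
    (hA _ (hc t ht)).comp_hasDerivAt t (hcd t)
  have hd1 : ∀ t ∈ Icc (0 : ℝ) 1, HasDerivAt (fun s => (G (c s)).1) (A (c t) (q - p)).1 t :=
    fun t ht => (ContinuousLinearMap.fst ℝ ℝ ℝ).hasFDerivAt.comp_hasDerivAt t (hd t ht)
  have hd2 : ∀ t ∈ Icc (0 : ℝ) 1, HasDerivAt (fun s => (G (c s)).2) (A (c t) (q - p)).2 t :=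
    fun t ht => (ContinuousLinearMap.snd ℝ ℝ ℝ).hasFDerivAt.comp_hasDerivAt t (hd t ht)
  have hc0 : c 0 = p := by simp [c]
  have hc1 : c 1 = q := by simp [c]
  have hne : (G q).1 - (G p).1 ≠ 0 := by
    intro h0
    obtain ⟨t, ht, ht'⟩ := exists_hasDerivAt_eq_zero (f := fun s => (G (c s)).1) zero_lt_one
      (fun t ht => (hd1 t ht).continuousAt.continuousWithinAt)
      (by simp only [hc0, hc1]; linarith) (fun t ht => hd1 t (Ioo_subset_Icc_self ht))
    exact (hA' _ (hc t (Ioo_subset_Icc_self ht)) _ hpq hcone).2 ht'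
  refine ⟨?_, hne⟩
  obtain ⟨t, ht, ht'⟩ := exists_ratio_hasDerivAt_eq_ratio_slope (fun s => (G (c s)).1) _
    zero_lt_one (fun t ht => (hd1 t ht).continuousAt.continuousWithinAt)
    (fun t ht => hd1 t (Ioo_subset_Icc_self ht)) (fun s => (G (c s)).2) _
    (fun t ht => (hd2 t ht).continuousAt.continuousWithinAt)
    (fun t ht => hd2 t (Ioo_subset_Icc_self ht))
  simp only [hc0, hc1] at ht'
  obtain ⟨h1, h2⟩ := hA' _ (hc t (Ioo_subset_Icc_self ht)) _ hpq hcone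
  have h3 : 0 < |(A (c t) (q - p)).1| := abs_pos.2 h2
  refine le_of_mul_le_mul_right ?_ h3
  rw [← abs_mul, ht', abs_mul]
  nlinarith [abs_nonneg ((G q).1 - (G p).1)]

/-- A map of a convex set whose derivatives send the cone of slope `1` into that of slope `θ`
preserves or reverses the cone order: the pairs in strict position form a connected set, on which
the difference of the first coordinates does not vanish. -/
lemma exists_monotone_of_mapsConeInto {G : ℝ × ℝ → ℝ × ℝ} {Ω : Set (ℝ × ℝ)} (hΩ : Convex ℝ Ω)
    (hG : ∀ z ∈ Ω, ∃ A, HasFDerivAt G A z ∧ MapsConeInto θ A) (hσ : σ = 1 ∨ σ = -1) :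
    ∃ σ' : ℝ, (σ' = 1 ∨ σ' = -1) ∧
      ∀ p ∈ Ω, ∀ q ∈ Ω, ConeLE 1 σ p q → ConeLE θ σ' (G p) (G q) := by
  let S : Set ((ℝ × ℝ) × ℝ × ℝ) :=
    {s | s.1 ∈ Ω ∧ s.2 ∈ Ω ∧ ConeLE 1 σ s.1 s.2 ∧ 0 < σ * (s.2.1 - s.1.1)}
  have hS : Convex ℝ S := by
    rintro ⟨p, q⟩ ⟨h1, h2, h3, h4⟩ ⟨p', q'⟩ ⟨h1', h2', h3', h4'⟩ s t hs ht hst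
    refine ⟨hΩ h1 h1' hs ht hst, hΩ h2 h2' hs ht hst, ?_, ?_⟩
    · simp only [ConeLE, Prod.fst_add, Prod.snd_add, Prod.smul_fst, Prod.smul_snd, smul_eq_mul,
        abs_le, one_mul] at *
      constructor <;> nlinarith
    · simp only [Prod.fst_add, Prod.snd_add, Prod.smul_fst, Prod.smul_snd, smul_eq_mul] at *
      obtain rfl : t = 1 - s := by linarith
      rcases hs.eq_or_lt with rfl | hs
      · simpa using h4'
      · nlinarith [mul_pos hs h4, mul_nonneg ht h4'.le]
  have hcont : ContinuousOn G Ω := fun z hz => by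
    obtain ⟨A, hA, -⟩ := hG z hz
    exact hA.continuousAt.continuousWithinAt
  have hφ : ContinuousOn (fun s : (ℝ × ℝ) × ℝ × ℝ => (G s.2).1 - (G s.1).1) S :=
    (continuous_fst.comp_continuousOn
      (hcont.comp continuous_snd.continuousOn fun s hs => hs.2.1)).sub
    (continuous_fst.comp_continuousOn (hcont.comp continuous_fst.continuousOn fun s hs => hs.1))
  have hchord : ∀ s ∈ S, |(G s.2).2 - (G s.1).2| ≤ θ * |(G s.2).1 - (G s.1).1| ∧
      (G s.2).1 - (G s.1).1 ≠ 0 := by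
    rintro ⟨p, q⟩ ⟨h1, h2, h3, h4⟩
    refine chord_image_of_mapsConeInto hΩ hG h1 h2 (fun h0 => ?_) ?_
    · rw [← Prod.fst_sub, h0] at h4
      simp at h4
    · simpa using h3.abs_le one_pos hσ
  -- pairs in order are equal or in strict position
  have hred : ∀ σ' : ℝ, (∀ s ∈ S, |(G s.1).1 - (G s.2).1| = σ' * ((G s.2).1 - (G s.1).1)) →
      ∀ p ∈ Ω, ∀ q ∈ Ω, ConeLE 1 σ p q → ConeLE θ σ' (G p) (G q) := by
    intro σ' h p hp q hq hpq
    rcases (hpq.nonneg one_pos).eq_or_lt with h0 | h0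
    · obtain rfl : q = p := by
        have := hpq.norm_sub hσ
        rwa [← h0, norm_eq_zero, sub_eq_zero] at this
      exact ConeLE.refl _ _ _
    · have hs : (p, q) ∈ S := ⟨hp, hq, hpq, h0⟩
      have := (hchord _ hs).1
      rwa [abs_sub_comm (G q).1, h _ hs] at this
  by_cases hpos : ∃ s ∈ S, 0 < (G s.2).1 - (G s.1).1
  · obtain ⟨s₀, hs₀, h₀⟩ := hpos
    refine ⟨1, Or.inl rfl, hred 1 fun s hs => ?_⟩
    rw [abs_sub_comm, one_mul, abs_of_nonneg]
    by_contra! hneg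
    obtain ⟨s', hs', h'⟩ := hS.isPreconnected.intermediate_value hs hs₀ hφ ⟨hneg.le, h₀.le⟩
    exact (hchord s' hs').2 h'
  · push Not at hpos
    refine ⟨-1, Or.inr rfl, hred (-1) fun s hs => ?_⟩
    rw [abs_sub_comm, abs_of_nonpos (hpos s hs)]
    ring

end ConeOrder

/-! ### Atlases adapted to an invariant cone field -/

section ConeAtlas

variable {M : Type*} [MetricSpace M] {ι : Type*}

/-- The points which a chart maps into the unit ball of the plane (for the sup norm). -/
def chartCore (e : OpenPartialHomeomorph M (ℝ × ℝ)) : Set M :=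
  e.source ∩ e ⁻¹' Metric.ball 0 1

/-- The order interval between two points of the core of a chart, for the cone order of the
coordinates. -/
def orderInterval (e : OpenPartialHomeomorph M (ℝ × ℝ)) (σ : ℝ) (a b : M) : Set M :=
  e.symm '' coneInterval σ (e a) (e b)

/-- A family of charts, the cores of which cover `M`, in whose coordinates the derivative of `F`
sends the horizontal cone of slope `1` into the horizontal cone of slope `θ`. -/
structure IsConeAtlas (F : M → M) (e : ι → OpenPartialHomeomorph M (ℝ × ℝ)) (θ : ℝ) : Prop where
  pos : 0 < θ
  lt_one : θ < 1
  closedBall_subset : ∀ i, Metric.closedBall 0 2 ⊆ (e i).target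
  cover : ∀ x, ∃ i, x ∈ chartCore (e i)
  mapsCone : ∀ i l, ∀ z ∈ Metric.ball (0 : ℝ × ℝ) 2, F ((e i).symm z) ∈ chartCore (e l) →
    ∃ A, HasFDerivAt (fun w => e l (F ((e i).symm w))) A z ∧ MapsConeInto θ A

lemma isOpen_chartCore (e : OpenPartialHomeomorph M (ℝ × ℝ)) : IsOpen (chartCore e) :=
  e.isOpen_inter_preimage Metric.isOpen_ball

lemma exists_pos_forall_of_finite [Finite ι] {P : ι → ℝ → Prop}
    (hP : ∀ i δ δ', 0 < δ' → δ' ≤ δ → P i δ → P i δ') (h : ∀ i, ∃ δ > 0, P i δ) :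
    ∃ δ > 0, ∀ i, P i δ := by
  have : ∀ᶠ δ in 𝓝[>] (0 : ℝ), ∀ i, P i δ := eventually_all.2 fun i => by
    obtain ⟨δ, hδ, h⟩ := h i
    filter_upwards [Ioc_mem_nhdsGT hδ] with δ' hδ' using hP i δ δ' hδ'.1 hδ'.2 h
  obtain ⟨δ, h1, h2⟩ := (this.and self_mem_nhdsWithin).exists
  exact ⟨δ, h2, h1⟩

section Chart

variable {e : OpenPartialHomeomorph M (ℝ × ℝ)} {σ : ℝ} {a b p : M}

lemma norm_lt_one_of_mem_chartCore (h : p ∈ chartCore e) : ‖e p‖ < 1 := by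
  simpa using h.2

lemma mem_orderInterval (hp : p ∈ e.source) (h1 : ConeLE 1 σ (e a) (e p))
    (h2 : ConeLE 1 σ (e p) (e b)) : p ∈ orderInterval e σ a b :=
  ⟨e p, ⟨h1, h2⟩, e.left_inv hp⟩

lemma orderInterval_chart (he : Metric.closedBall 0 2 ⊆ e.target) (hσ : σ = 1 ∨ σ = -1)
    (ha : a ∈ chartCore e) (hb : b ∈ chartCore e) (hp : p ∈ orderInterval e σ a b) :
    e p ∈ coneInterval σ (e a) (e b) ∧ e p ∈ Metric.ball 0 2 ∧ p ∈ e.source := by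
  obtain ⟨z, hz, rfl⟩ := hp
  have h2 := norm_lt_two_of_mem_coneInterval hσ (norm_lt_one_of_mem_chartCore ha)
    (norm_lt_one_of_mem_chartCore hb) hz
  have ht : z ∈ e.target := he (by simpa using h2.le)
  rw [e.right_inv ht]
  exact ⟨hz, by simpa using h2, e.map_target ht⟩

lemma exists_modulus_chart (he : Metric.closedBall 0 2 ⊆ e.target) {η : ℝ} (hη : 0 < η) :
    ∃ δ > 0, ∀ x ∈ chartCore e, ∀ y, dist x y < δ → y ∈ e.source ∧ ‖e y - e x‖ < η := by
  have hsub : Metric.closedBall (0 : ℝ × ℝ) 1 ⊆ e.target :=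
    (Metric.closedBall_subset_closedBall one_le_two).trans he
  have hK : IsCompact (e.symm '' Metric.closedBall 0 1) :=
    (isCompact_closedBall _ _).image_of_continuousOn (e.continuousOn_symm.mono hsub)
  have hKs : e.symm '' Metric.closedBall 0 1 ⊆ e.source := by
    rintro _ ⟨z, hz, rfl⟩
    exact e.map_target (hsub hz)
  have hcore : ∀ x ∈ chartCore e, x ∈ e.symm '' Metric.closedBall 0 1 := fun x hx =>
    ⟨e x, Metric.ball_subset_closedBall hx.2, e.left_inv hx.1⟩
  obtain ⟨δ, hδ, h⟩ := hK.exists_thickening_subset_open e.open_source hKs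
  obtain ⟨δ', hδ', h'⟩ := Metric.mem_uniformity_dist.1 (hK.uniformContinuousAt_of_continuousAt e
    (fun x hx => e.continuousAt (hKs hx)) (Metric.dist_mem_uniformity hη))
  refine ⟨min δ δ', lt_min hδ hδ', fun x hx y hxy => ⟨h ?_, ?_⟩⟩
  · exact Metric.mem_thickening_iff.2
      ⟨x, hcore x hx, (dist_comm y x).trans_lt (hxy.trans_le (min_le_left _ _))⟩
  · rw [← dist_eq_norm, dist_comm]
    exact h' (hxy.trans_le (min_le_right _ _)) (hcore x hx)

lemma exists_modulus_chart_symm (he : Metric.closedBall 0 2 ⊆ e.target) {ε : ℝ} (hε : 0 < ε) :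
    ∃ η > 0, ∀ z ∈ Metric.closedBall (0 : ℝ × ℝ) 2, ∀ w ∈ Metric.closedBall (0 : ℝ × ℝ) 2,
      ‖z - w‖ < η → dist (e.symm z) (e.symm w) < ε := by
  obtain ⟨η, hη, h⟩ := Metric.uniformContinuousOn_iff.1
    ((isCompact_closedBall (0 : ℝ × ℝ) 2).uniformContinuousOn_of_continuous
      (e.continuousOn_symm.mono he)) ε hε
  exact ⟨η, hη, fun z hz w hw hzw => h z hz w hw (by rwa [dist_eq_norm])⟩

end Chart

namespace IsConeAtlas

variable {F : M → M} {e : ι → OpenPartialHomeomorph M (ℝ × ℝ)} {θ : ℝ}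

/-- Order intervals between close points are small. -/
lemma exists_orderInterval_small [Finite ι] (h : IsConeAtlas F e θ) {ε : ℝ} (hε : 0 < ε) :
    ∃ δ > 0, ∀ i, ∀ σ : ℝ, (σ = 1 ∨ σ = -1) → ∀ a ∈ chartCore (e i), ∀ b ∈ chartCore (e i),
      dist a b < δ → ∀ p ∈ orderInterval (e i) σ a b, dist p a < ε := by
  refine exists_pos_forall_of_finite
    (fun i δ δ' _ hle H σ hσ a ha b hb hab => H σ hσ a ha b hb (hab.trans_le hle)) fun i => ?_
  obtain ⟨η, hη, h1⟩ := exists_modulus_chart_symm (h.closedBall_subset i) hε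
  obtain ⟨δ, hδ, h2⟩ := exists_modulus_chart (h.closedBall_subset i) hη
  refine ⟨δ, hδ, fun σ hσ a ha b hb hab p hp => ?_⟩
  obtain ⟨hp1, hp2, hp3⟩ := orderInterval_chart (h.closedBall_subset i) hσ ha hb hp
  have := h1 (e i p) (Metric.ball_subset_closedBall hp2) (e i a)
    (by simpa using (norm_lt_one_of_mem_chartCore ha).le.trans one_le_two)
    ((hp1.1.norm_sub_le hp1.2 hσ).trans_lt (h2 a ha b hab).2)
  rwa [(e i).left_inv hp3, (e i).left_inv ha.1] at this

/-- Order intervals between points which are not too close contain a ball of definite size. -/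
lemma exists_ball_subset_orderInterval [Finite ι] (h : IsConeAtlas F e θ) {c : ℝ} (hc : 0 < c) :
    ∃ ρ > 0, ∀ i, ∀ σ : ℝ, (σ = 1 ∨ σ = -1) → ∀ a ∈ chartCore (e i), ∀ b ∈ chartCore (e i),
      ConeLE θ σ (e i a) (e i b) → c ≤ dist a b →
      ∃ z, Metric.ball z ρ ⊆ orderInterval (e i) σ a b := by
  refine exists_pos_forall_of_finite (fun i δ δ' _ hle H σ hσ a ha b hb hab hd =>
    (H σ hσ a ha b hb hab hd).imp fun z hz => (Metric.ball_subset_ball hle).trans hz) fun i => ?_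
  obtain ⟨η, hη, h1⟩ := exists_modulus_chart_symm (h.closedBall_subset i) hc
  have hθ := h.lt_one
  obtain ⟨ρ, hρ, h2⟩ := exists_modulus_chart (h.closedBall_subset i)
    (show 0 < (1 - θ) / 4 * η from mul_pos (by linarith) hη)
  refine ⟨ρ, hρ, fun σ hσ a ha b hb hab hd => ⟨(e i).symm (midpoint ℝ (e i a) (e i b)), ?_⟩⟩
  have hball : ∀ x ∈ chartCore (e i), e i x ∈ Metric.closedBall (0 : ℝ × ℝ) 2 := fun x hx => by
    simpa using (norm_lt_one_of_mem_chartCore hx).le.trans one_le_two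
  have hη' : η ≤ ‖e i b - e i a‖ := by
    by_contra! hlt
    have := h1 _ (hball b hb) _ (hball a ha) hlt
    rw [(e i).left_inv ha.1, (e i).left_inv hb.1, dist_comm] at this
    linarith
  have hm : midpoint ℝ (e i a) (e i b) ∈ Metric.ball (0 : ℝ × ℝ) 1 :=
    (convex_ball (0 : ℝ × ℝ) 1).midpoint_mem ha.2 hb.2
  have hmt : midpoint ℝ (e i a) (e i b) ∈ (e i).target :=
    h.closedBall_subset i (Metric.ball_subset_closedBall
      (Metric.ball_subset_ball one_le_two hm))
  intro y hy
  obtain ⟨hy1, hy2⟩ := h2 ((e i).symm (midpoint ℝ (e i a) (e i b)))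
    ⟨(e i).map_target hmt, by simpa [(e i).right_inv hmt] using hm⟩ y
    (by rwa [dist_comm])
  rw [(e i).right_inv hmt] at hy2
  refine ⟨e i y, mem_coneInterval_of_near_midpoint hσ hab h.pos hθ
    (hy2.le.trans (mul_le_mul_of_nonneg_left hη' (by linarith))), (e i).left_inv hy1⟩

/-- `F` is monotone on order intervals whose images lie in one chart. -/
lemma exists_monotoneOn_orderInterval (h : IsConeAtlas F e θ) {i l : ι} {σ : ℝ}
    (hσ : σ = 1 ∨ σ = -1) {a b : M} (ha : a ∈ chartCore (e i)) (hb : b ∈ chartCore (e i))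
    (hF : MapsTo F (orderInterval (e i) σ a b) (chartCore (e l))) :
    ∃ σ' : ℝ, (σ' = 1 ∨ σ' = -1) ∧ ∀ p ∈ orderInterval (e i) σ a b,
      ∀ q ∈ orderInterval (e i) σ a b, ConeLE 1 σ (e i p) (e i q) →
        ConeLE θ σ' (e l (F p)) (e l (F q)) := by
  obtain ⟨σ', hσ', H⟩ := exists_monotone_of_mapsConeInto (σ := σ)
    (convex_coneInterval σ (e i a) (e i b))
    (fun z hz => h.mapsCone i l z (mem_ball_zero_iff.2 (norm_lt_two_of_mem_coneInterval hσ
      (norm_lt_one_of_mem_chartCore ha) (norm_lt_one_of_mem_chartCore hb) hz))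
      (hF ⟨z, hz, rfl⟩)) hσ
  refine ⟨σ', hσ', fun p hp q hq hpq => ?_⟩
  obtain ⟨hp1, -, hp3⟩ := orderInterval_chart (h.closedBall_subset i) hσ ha hb hp
  obtain ⟨hq1, -, hq3⟩ := orderInterval_chart (h.closedBall_subset i) hσ ha hb hq
  have := H _ hp1 _ hq1 hpq
  rwa [(e i).left_inv hp3, (e i).left_inv hq3] at this

/-- `r` is a scale below which `F` acts monotonically: order intervals between `r`-close points are
mapped into the core of a chart, and the cone order is preserved or reversed. -/
def IsMonotoneScale (F : M → M) (e : ι → OpenPartialHomeomorph M (ℝ × ℝ)) (θ r : ℝ) : Prop :=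
  ∀ i, ∀ σ : ℝ, (σ = 1 ∨ σ = -1) → ∀ a ∈ chartCore (e i), ∀ b ∈ chartCore (e i), dist a b < r →
    ∃ l, ∃ σ' : ℝ, (σ' = 1 ∨ σ' = -1) ∧ MapsTo F (orderInterval (e i) σ a b) (chartCore (e l)) ∧
      ∀ p ∈ orderInterval (e i) σ a b, ∀ q ∈ orderInterval (e i) σ a b,
        ConeLE 1 σ (e i p) (e i q) → ConeLE θ σ' (e l (F p)) (e l (F q))

lemma exists_image_orderInterval_small [CompactSpace M] [Finite ι] (h : IsConeAtlas F e θ)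
    (hF : Continuous F) {ε : ℝ} (hε : 0 < ε) :
    ∃ δ > 0, ∀ i, ∀ σ : ℝ, (σ = 1 ∨ σ = -1) → ∀ a ∈ chartCore (e i), ∀ b ∈ chartCore (e i),
      dist a b < δ → ∀ p ∈ orderInterval (e i) σ a b, dist (F p) (F a) < ε := by
  obtain ⟨ε', hε', hmod⟩ := Metric.uniformContinuous_iff.1
    (CompactSpace.uniformContinuous_of_continuous hF) ε hε
  obtain ⟨δ, hδ, H⟩ := h.exists_orderInterval_small hε'
  exact ⟨δ, hδ, fun i σ hσ a ha b hb hab p hp => hmod (H i σ hσ a ha b hb hab p hp)⟩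

lemma exists_isMonotoneScale [CompactSpace M] [Finite ι] (h : IsConeAtlas F e θ)
    (hF : Continuous F) : ∃ r > 0, IsMonotoneScale F e θ r := by
  obtain ⟨ρ, hρ, hleb⟩ := lebesgue_number_lemma_of_metric (isCompact_univ (X := M))
    (fun i => isOpen_chartCore (e i)) (fun x _ => mem_iUnion.2 (h.cover x))
  obtain ⟨r, hr, H⟩ := h.exists_image_orderInterval_small hF hρ
  refine ⟨r, hr, fun i σ hσ a ha b hb hab => ?_⟩
  obtain ⟨l, hl⟩ := hleb (F a) (mem_univ _)
  have hm : MapsTo F (orderInterval (e i) σ a b) (chartCore (e l)) := fun p hp =>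
    hl (H i σ hσ a ha b hb hab p hp)
  obtain ⟨σ', hσ', H'⟩ := h.exists_monotoneOn_orderInterval hσ ha hb hm
  exact ⟨l, σ', hσ', hm, H'⟩

/-- As long as the iterates of two ordered points remain close to each other, they remain ordered,
and the iterates of their order interval are caught between them. -/
lemma exists_mapsTo_iterate_orderInterval (h : IsConeAtlas F e θ) {r : ℝ}
    (hr : IsMonotoneScale F e θ r) {i : ι} {σ : ℝ} (hσ : σ = 1 ∨ σ = -1) {a b : M}
    (ha : a ∈ chartCore (e i)) (hb : b ∈ chartCore (e i)) (hab : ConeLE 1 σ (e i a) (e i b))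
    (m : ℕ) (hm : ∀ n < m, dist (F^[n] a) (F^[n] b) < r) :
    ∃ l, ∃ σ' : ℝ, (σ' = 1 ∨ σ' = -1) ∧ F^[m] a ∈ chartCore (e l) ∧ F^[m] b ∈ chartCore (e l) ∧
      ConeLE 1 σ' (e l (F^[m] a)) (e l (F^[m] b)) ∧
      MapsTo F^[m] (orderInterval (e i) σ a b) (orderInterval (e l) σ' (F^[m] a) (F^[m] b)) := by
  induction m with
  | zero => exact ⟨i, σ, hσ, ha, hb, hab, fun p hp => hp⟩
  | succ m ih =>
    obtain ⟨l, τ, hτ, ha', hb', hab', hmaps⟩ := ih fun n hn => hm n (by omega)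
    obtain ⟨l', τ', hτ', hcore, hmono⟩ := hr l τ hτ _ ha' _ hb' (hm m (by omega))
    have hma := mem_orderInterval ha'.1 (ConeLE.refl 1 τ _) hab'
    have hmb := mem_orderInterval hb'.1 hab' (ConeLE.refl 1 τ _)
    have hmono' : ∀ p ∈ orderInterval (e l) τ (F^[m] a) (F^[m] b),
        ∀ q ∈ orderInterval (e l) τ (F^[m] a) (F^[m] b), ConeLE 1 τ (e l p) (e l q) →
        ConeLE 1 τ' (e l' (F p)) (e l' (F q)) := fun p hp q hq hpq =>
      (hmono p hp q hq hpq).mono h.pos h.lt_one.le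
    simp only [iterate_succ_apply']
    refine ⟨l', τ', hτ', hcore hma, hcore hmb, hmono' _ hma _ hmb hab', fun p hp => ?_⟩
    have hp' := hmaps hp
    obtain ⟨hp1, -, -⟩ := orderInterval_chart (h.closedBall_subset l) hτ ha' hb' hp'
    rw [iterate_succ_apply']
    exact mem_orderInterval (hcore hp').1 (hmono' _ hma _ hp' hp1.1) (hmono' _ hp' _ hmb hp1.2)

/-! ### Transitivity and cone invariance imply sensitivity -/

/-- A transitive map, a power of which preserves a cone field strictly, is sensitive. Otherwise,
iterates `F^m` come arbitrarily close to the identity, while a short chord of slope `1` issued from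
the equicontinuity point is mapped by `F^m` to a chord of slope at most `θ < 1`. -/
theorem isSensitive [CompactSpace M] [Finite ι] {f : M → M} (hf : Continuous f) {k : ℕ}
    (hk : 1 ≤ k) (h : IsConeAtlas f^[k] e θ) {x₀ : M} [(𝓝[≠] x₀).NeBot]
    (hx₀ : Dense (range fun n : ℕ => f^[n] x₀)) : IsSensitive f^[k] := by
  refine IsSensitive.iterate hf ?_ hk
  by_contra hns
  set F := f^[k] with hFdef
  have hF : Continuous F := hf.iterate k
  obtain ⟨i, hi⟩ := h.cover x₀
  obtain ⟨ρ, hρ, hball⟩ := Metric.isOpen_iff.1 (isOpen_chartCore (e i)) x₀ hi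
  obtain ⟨r, hr, hmono⟩ := h.exists_isMonotoneScale hF
  obtain ⟨δ, hδ, hsmall⟩ := h.exists_image_orderInterval_small hF (half_pos hρ)
  obtain ⟨δ', hδ', hequi⟩ := equicontinuous_of_not_isSensitive hf hx₀ hns (lt_min hr hδ)
  -- the second endpoint `b` of the chord of slope `1`
  have hline0 : Tendsto (fun t : ℝ => e i x₀ + (t, t)) (𝓝[>] 0) (𝓝 (e i x₀)) := by
    have h1 : Continuous fun t : ℝ => e i x₀ + (t, t) := by fun_prop
    have h2 := h1.tendsto 0
    rw [Prod.mk_zero_zero, add_zero] at h2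
    exact h2.mono_left nhdsWithin_le_nhds
  have hline : Tendsto (fun t : ℝ => (e i).symm (e i x₀ + (t, t))) (𝓝[>] 0) (𝓝 x₀) := by
    have h2 := ((e i).continuousAt_symm ((e i).map_source hi.1)).tendsto.comp hline0
    rwa [(e i).left_inv hi.1] at h2
  have htarget : ∀ᶠ t : ℝ in 𝓝[>] 0, e i x₀ + (t, t) ∈ (e i).target :=
    hline0.eventually ((e i).open_target.mem_nhds ((e i).map_source hi.1))
  obtain ⟨t, ⟨⟨htt, htb⟩, htd⟩, ht0⟩ := (((htarget.and
    (hline.eventually ((isOpen_chartCore (e i)).mem_nhds hi))).and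
    (hline.eventually (Metric.ball_mem_nhds x₀ hδ'))).and self_mem_nhdsWithin).exists
  replace ht0 : 0 < t := ht0
  set b := (e i).symm (e i x₀ + (t, t)) with hb
  have heb : e i b = e i x₀ + (t, t) := (e i).right_inv htt
  have hclose : ∀ n, dist (F^[n] x₀) (F^[n] b) < min r δ := fun n => by
    rw [hFdef, ← iterate_mul]
    exact hequi x₀ b (by simpa using hδ') htd _
  have hab : ConeLE 1 1 (e i x₀) (e i b) := by
    simp [ConeLE, heb, abs_of_pos ht0]
  -- iterates close to the identity
  have hk0 : (0 : ℝ) < k := by exact_mod_cast hk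
  have hkey : ∀ ε > 0, ε ≤ ρ / 2 → ∃ m : ℕ, (∀ y, dist (F^[m] y) y ≤ ε) ∧
      |(e i (F^[m] b)).2 - (e i (F^[m] x₀)).2| ≤
        θ * |(e i (F^[m] b)).1 - (e i (F^[m] x₀)).1| := by
    intro ε hε hερ
    obtain ⟨m, hm1, hm⟩ := exists_iterate_near_id_of_not_isSensitive hf hx₀ hns (div_pos hε hk0)
    have hm' : ∀ y, dist (F^[m] y) y ≤ ε := fun y =>
      (exists_pow_near_id hm k y).trans_eq (by field_simp)
    obtain ⟨m, rfl⟩ := Nat.exists_eq_add_of_le' hm1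
    refine ⟨m + 1, hm', ?_⟩
    obtain ⟨l, σ, hσ, ha', hb', hab', -⟩ := h.exists_mapsTo_iterate_orderInterval hmono
      (Or.inl rfl) hi htb hab m fun n _ => (hclose n).trans_le (min_le_left _ _)
    have hmaps : MapsTo F (orderInterval (e l) σ (F^[m] x₀) (F^[m] b)) (chartCore (e i)) := by
      intro p hp
      refine hball ?_
      have h1 := hsmall l σ hσ _ ha' _ hb' ((hclose m).trans_le (min_le_right _ _)) p hp
      have h2 := hm' x₀
      rw [iterate_succ_apply'] at h2
      rw [Metric.mem_ball]
      linarith [dist_triangle (F p) (F (F^[m] x₀)) x₀]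
    obtain ⟨σ', hσ', H⟩ := h.exists_monotoneOn_orderInterval hσ ha' hb' hmaps
    have := (H _ (mem_orderInterval ha'.1 (ConeLE.refl 1 σ _) hab') _
      (mem_orderInterval hb'.1 hab' (ConeLE.refl 1 σ _)) hab').abs_le h.pos hσ'
    rwa [← iterate_succ_apply' F, ← iterate_succ_apply' F] at this
  have hpos : ∀ n : ℕ, 0 < ρ / 2 / ((n : ℝ) + 1) := fun n => by positivity
  choose m hm hslope using fun n : ℕ => hkey (ρ / 2 / ((n : ℝ) + 1)) (hpos n)
    (div_le_self (half_pos hρ).le (by linarith [n.cast_nonneg (α := ℝ)]))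
  have hlim : ∀ y, Tendsto (fun n => F^[m n] y) atTop (𝓝 y) := fun y => by
    refine tendsto_iff_dist_tendsto_zero.2 (squeeze_zero (fun _ => dist_nonneg)
      (fun n => hm n y) ?_)
    have := (tendsto_one_div_add_atTop_nhds_zero_nat (𝕜 := ℝ)).const_mul (ρ / 2)
    simpa [div_eq_mul_inv] using this
  have hla := ((e i).continuousAt hi.1).tendsto.comp (hlim x₀)
  have hlb := ((e i).continuousAt htb.1).tendsto.comp (hlim b)
  have hlimit : |(e i b).2 - (e i x₀).2| ≤ θ * |(e i b).1 - (e i x₀).1| :=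
    le_of_tendsto_of_tendsto'
      (((continuous_snd.tendsto _).comp hlb).sub ((continuous_snd.tendsto _).comp hla)).abs
      ((((continuous_fst.tendsto _).comp hlb).sub
        ((continuous_fst.tendsto _).comp hla)).abs.const_mul θ) hslope
  simp only [heb, Prod.snd_add, Prod.fst_add, add_sub_cancel_left, abs_of_pos ht0] at hlimit
  nlinarith [h.lt_one]

end IsConeAtlas

end ConeAtlas

/-! ### Exponential growth of ordered arcs -/

section Growth

variable {M : Type*} [MetricSpace M] {ι : Type*}

/-- An arc in the core of a chart, parametrized by `[s, t]`, which is increasing for the cone order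
of slope `θ` of the coordinates. -/
structure IsOrderedArc (e : OpenPartialHomeomorph M (ℝ × ℝ)) (θ σ : ℝ) (γ : ℝ → M) (s t : ℝ) :
    Prop where
  le : s ≤ t
  continuousOn : ContinuousOn γ (Icc s t)
  mem_core : ∀ u ∈ Icc s t, γ u ∈ chartCore e
  ordered : ∀ u ∈ Icc s t, ∀ v ∈ Icc s t, u ≤ v → ConeLE θ σ (e (γ u)) (e (γ v))

lemma IsOrderedArc.subarc {e : OpenPartialHomeomorph M (ℝ × ℝ)} {θ σ : ℝ} {γ : ℝ → M}
    {s t s' t' : ℝ} (h : IsOrderedArc e θ σ γ s t) (hs : s ≤ s') (hle : s' ≤ t') (ht : t' ≤ t) :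
    IsOrderedArc e θ σ γ s' t' where
  le := hle
  continuousOn := h.continuousOn.mono (Icc_subset_Icc hs ht)
  mem_core u hu := h.mem_core u (Icc_subset_Icc hs ht hu)
  ordered u hu v hv := h.ordered u (Icc_subset_Icc hs ht hu) v (Icc_subset_Icc hs ht hv)

lemma exists_dist_left_eq {γ : ℝ → M} {s t δ : ℝ} (hst : s ≤ t) (hγ : ContinuousOn γ (Icc s t))
    (hδ : 0 ≤ δ) (h : δ ≤ dist (γ s) (γ t)) : ∃ m ∈ Icc s t, dist (γ s) (γ m) = δ :=
  intermediate_value_Icc hst (fun u hu => tendsto_const_nhds.dist (hγ u hu)) ⟨by simpa using hδ, h⟩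

namespace IsConeAtlas

variable {F : M → M} {e : ι → OpenPartialHomeomorph M (ℝ × ℝ)} {θ : ℝ}

lemma exists_isOrderedArc_iterate (h : IsConeAtlas F e θ) (hF : Continuous F) {r : ℝ}
    (hr : IsMonotoneScale F e θ r) {i : ι} {σ : ℝ} (hσ : σ = 1 ∨ σ = -1) {γ : ℝ → M} {s t : ℝ}
    (hγ : IsOrderedArc (e i) θ σ γ s t) (m : ℕ)
    (hm : ∀ n < m, dist (F^[n] (γ s)) (F^[n] (γ t)) < r) :
    ∃ l, ∃ σ' : ℝ, (σ' = 1 ∨ σ' = -1) ∧ IsOrderedArc (e l) θ σ' (F^[m] ∘ γ) s t := by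
  induction m with
  | zero => exact ⟨i, σ, hσ, hγ⟩
  | succ m ih =>
    obtain ⟨l, τ, hτ, harc⟩ := ih fun n hn => hm n (by omega)
    have hs : s ∈ Icc s t := left_mem_Icc.2 hγ.le
    have ht : t ∈ Icc s t := right_mem_Icc.2 hγ.le
    obtain ⟨l', τ', hτ', hmaps, hmono⟩ := hr l τ hτ _ (harc.mem_core s hs) _ (harc.mem_core t ht)
      (hm m (by omega))
    have hint : ∀ u ∈ Icc s t, (F^[m] ∘ γ) u ∈
        orderInterval (e l) τ ((F^[m] ∘ γ) s) ((F^[m] ∘ γ) t) := fun u hu =>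
      mem_orderInterval (harc.mem_core u hu).1
        ((harc.ordered s hs u hu hu.1).mono h.pos h.lt_one.le)
        ((harc.ordered u hu t ht hu.2).mono h.pos h.lt_one.le)
    have heq : F^[m + 1] ∘ γ = F ∘ F^[m] ∘ γ := by rw [iterate_succ', comp_assoc]
    rw [heq]
    exact ⟨l', τ', hτ', hγ.le, hF.comp_continuousOn harc.continuousOn,
      fun u hu => hmaps (hint u hu), fun u hu v hv huv => hmono _ (hint u hu) _ (hint v hv)
        ((harc.ordered u hu v hv huv).mono h.pos h.lt_one.le)⟩

/-- If `F` is sensitive, then the endpoints of ordered arcs separate to a definite distance: were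
they to stay close, so would all points of their order interval, which contains a ball. The
time needed is bounded in terms of the initial distance. -/
lemma exists_separation_time [CompactSpace M] [Finite ι] (h : IsConeAtlas F e θ)
    (hsens : IsSensitive F) {r : ℝ} (hr0 : 0 < r) (hr : IsMonotoneScale F e θ r) :
    ∃ δ > 0, 2 * δ ≤ r ∧ ∀ c > 0, ∃ N : ℕ, ∀ i, ∀ σ : ℝ, (σ = 1 ∨ σ = -1) →
      ∀ a ∈ chartCore (e i), ∀ b ∈ chartCore (e i), ConeLE θ σ (e i a) (e i b) →
      c ≤ dist a b → ∃ n ≤ N, 2 * δ ≤ dist (F^[n] a) (F^[n] b) ∧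
        ∀ m < n, dist (F^[m] a) (F^[m] b) < 2 * δ := by
  obtain ⟨ε, hε, hsens⟩ := hsens
  obtain ⟨δ, hδ, hsmall⟩ := h.exists_orderInterval_small (half_pos hε)
  have hmin : 0 < min r δ := lt_min hr0 hδ
  refine ⟨min r δ / 2, half_pos hmin, by linarith [min_le_left r δ], fun c hc => ?_⟩
  rw [mul_div_cancel₀ _ two_ne_zero]
  obtain ⟨ρ, hρ, hball⟩ := h.exists_ball_subset_orderInterval hc
  obtain ⟨N, hN⟩ := exists_uniform_separation_time hsens hρ
  refine ⟨N, fun i σ hσ a ha b hb hab hd => ?_⟩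
  have hex : ∃ n, n ≤ N ∧ min r δ ≤ dist (F^[n] a) (F^[n] b) := by
    by_contra! hlt
    obtain ⟨z, hz⟩ := hball i σ hσ a ha b hb hab hd
    obtain ⟨n, hn, x, hx, y, hy, hxy⟩ := hN z
    obtain ⟨l, τ, hτ, ha', hb', -, hmaps⟩ := h.exists_mapsTo_iterate_orderInterval hr hσ ha hb
      (hab.mono h.pos h.lt_one.le) n
      fun m hm => (hlt m (hm.le.trans hn)).trans_le (min_le_left _ _)
    have hnear : ∀ p ∈ orderInterval (e i) σ a b, dist (F^[n] p) (F^[n] a) < ε / 2 := fun p hp =>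
      hsmall l τ hτ _ ha' _ hb' ((hlt n hn).trans_le (min_le_right _ _)) _ (hmaps hp)
    linarith [hnear x (hz hx), hnear y (hz hy),
      dist_triangle_right (F^[n] x) (F^[n] y) (F^[n] a)]
  classical
  refine ⟨Nat.find hex, (Nat.find_spec hex).1, (Nat.find_spec hex).2, fun m hm => ?_⟩
  have := Nat.find_min hex hm
  rw [not_and, not_le] at this
  exact this (hm.le.trans (Nat.find_spec hex).1)

/-- Iterating the separation of endpoints: after a bounded time, an ordered arc of diameter `δ`
contains two consecutive arcs of diameter `δ`, so that its length grows like a power of `2`. -/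
lemma exists_doubling [CompactSpace M] [Finite ι] {f : M → M} (hf : Continuous f) {k : ℕ}
    (hk : 1 ≤ k) (h : IsConeAtlas f^[k] e θ) {δ : ℝ} (hδ : 0 < δ) {r : ℝ}
    (hr : IsMonotoneScale f^[k] e θ r) (hδr : 2 * δ ≤ r) {N : ℕ}
    (hN : ∀ i, ∀ σ : ℝ, (σ = 1 ∨ σ = -1) →
      ∀ a ∈ chartCore (e i), ∀ b ∈ chartCore (e i), ConeLE θ σ (e i a) (e i b) →
      δ ≤ dist a b → ∃ n ≤ N, 2 * δ ≤ dist ((f^[k])^[n] a) ((f^[k])^[n] b) ∧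
        ∀ m < n, dist ((f^[k])^[m] a) ((f^[k])^[m] b) < 2 * δ) :
    ∃ c > 0, ∀ n : ℕ, ∀ i, ∀ σ : ℝ, (σ = 1 ∨ σ = -1) → ∀ (γ : ℝ → M) (s t : ℝ),
      IsOrderedArc (e i) θ σ γ s t → dist (γ s) (γ t) = δ →
      ENNReal.ofReal (c * 2 ^ (n / (k * N))) ≤ eVariationOn (f^[n] ∘ γ) (Icc s t) := by
  obtain ⟨c, hc, hmod⟩ := exists_modulus_iterate hf (k * N) hδ
  refine ⟨c, hc, fun n => ?_⟩
  induction n using Nat.strong_induction_on with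
  | _ n ih =>
  intro i σ hσ γ s t hγ hd
  have hs : s ∈ Icc s t := left_mem_Icc.2 hγ.le
  have ht : t ∈ Icc s t := right_mem_Icc.2 hγ.le
  obtain ⟨q, hqN, hq, hlt⟩ := hN i σ hσ _ (hγ.mem_core s hs) _ (hγ.mem_core t ht)
    (hγ.ordered s hs t ht hγ.le) hd.ge
  have hq0 : 1 ≤ q := by
    rcases Nat.eq_zero_or_pos q with rfl | h0
    · simp only [iterate_zero, id] at hq
      linarith
    · exact h0
  have hkq : k * q ≤ k * N := Nat.mul_le_mul_left k hqN
  have hkq0 : 1 ≤ k * q := Nat.mul_pos hk hq0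
  rw [← iterate_mul] at hq
  rcases Nat.lt_or_ge n (k * q) with hn | hn
  · -- before the separation time, the endpoints are not too close
    rw [Nat.div_eq_of_lt (hn.trans_le hkq), pow_zero, mul_one]
    refine le_trans ?_ (eVariationOn.edist_le (f^[n] ∘ γ) hs ht)
    rw [edist_dist]
    refine ENNReal.ofReal_le_ofReal (le_of_not_gt fun hclose => ?_)
    have := hmod (k * q - n) ((Nat.sub_le _ _).trans hkq) _ _ hclose
    rw [comp_apply, comp_apply, ← iterate_add_apply, ← iterate_add_apply,
      Nat.sub_add_cancel hn.le] at this
    linarith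
  · obtain ⟨l, τ, hτ, harc⟩ := h.exists_isOrderedArc_iterate (hf.iterate k) hr hσ hγ q
      fun m hm => (hlt m hm).trans_le hδr
    rw [← iterate_mul] at harc
    obtain ⟨m₁, hm₁, hd₁⟩ := exists_dist_left_eq hγ.le harc.continuousOn hδ.le (by
      simp only [comp_apply]
      linarith)
    have harc' := harc.subarc hm₁.1 hm₁.2 le_rfl
    obtain ⟨m₂, hm₂, hd₂⟩ := exists_dist_left_eq hm₁.2 harc'.continuousOn hδ.le (by
      have := dist_triangle ((f^[k * q] ∘ γ) s) ((f^[k * q] ∘ γ) m₁) ((f^[k * q] ∘ γ) t)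
      simp only [comp_apply] at *
      linarith)
    obtain ⟨j, rfl⟩ := Nat.exists_eq_add_of_le' hn
    have h1 := ih j (by omega) l τ hτ _ _ _ (harc.subarc le_rfl hm₁.1 hm₁.2) hd₁
    have h2 := ih j (by omega) l τ hτ _ _ _ (harc.subarc hm₁.1 hm₂.1 hm₂.2) hd₂
    rw [← comp_assoc, ← iterate_add] at h1 h2
    have hN0 : 0 < k * N := hkq0.trans hkq
    calc ENNReal.ofReal (c * 2 ^ ((j + k * q) / (k * N)))
        ≤ ENNReal.ofReal (c * 2 ^ (j / (k * N)) + c * 2 ^ (j / (k * N))) := by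
          refine ENNReal.ofReal_le_ofReal ?_
          have hdiv : (j + k * q) / (k * N) ≤ j / (k * N) + 1 := by
            rw [← Nat.add_div_right _ hN0]
            exact Nat.div_le_div_right (by omega)
          have := pow_le_pow_right₀ (one_le_two (α := ℝ)) hdiv
          rw [pow_succ] at this
          nlinarith
      _ = ENNReal.ofReal (c * 2 ^ (j / (k * N))) + ENNReal.ofReal (c * 2 ^ (j / (k * N))) :=
          ENNReal.ofReal_add (by positivity) (by positivity)
      _ ≤ eVariationOn (f^[j + k * q] ∘ γ) (Icc s m₁) +
          eVariationOn (f^[j + k * q] ∘ γ) (Icc m₁ m₂) := add_le_add h1 h2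
      _ = eVariationOn (f^[j + k * q] ∘ γ) (Icc s m₂) := by
          simpa using eVariationOn.Icc_add_Icc (f^[j + k * q] ∘ γ) (s := univ) hm₁.1 hm₂.1
            (mem_univ _)
      _ ≤ eVariationOn (f^[j + k * q] ∘ γ) (Icc s t) :=
          eVariationOn.mono _ (Icc_subset_Icc le_rfl hm₂.2)

/-- The length of the iterates of ordered arcs grows exponentially, at a uniform rate. -/
theorem exists_exponential_growth [CompactSpace M] [Finite ι] {f : M → M} (hf : Continuous f)
    {k : ℕ} (hk : 1 ≤ k) (h : IsConeAtlas f^[k] e θ) (hsens : IsSensitive f^[k]) :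
    ∃ R : ℝ, 1 < R ∧ ∀ i, ∀ σ : ℝ, (σ = 1 ∨ σ = -1) → ∀ (γ : ℝ → M) (s t : ℝ),
      IsOrderedArc (e i) θ σ γ s t → γ s ≠ γ t →
      ∃ c : ℝ, 0 < c ∧ ∀ n : ℕ, ENNReal.ofReal (c * R ^ n) ≤
        eVariationOn (f^[n] ∘ γ) (Icc s t) := by
  obtain ⟨r, hr0, hr⟩ := h.exists_isMonotoneScale (hf.iterate k)
  obtain ⟨δ, hδ, hδr, hsep⟩ := h.exists_separation_time hsens hr0 hr
  obtain ⟨N, hN⟩ := hsep δ hδ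
  -- enlarge the bound on the separation time to make it positive
  replace hN : ∀ i, ∀ σ : ℝ, (σ = 1 ∨ σ = -1) →
      ∀ a ∈ chartCore (e i), ∀ b ∈ chartCore (e i), ConeLE θ σ (e i a) (e i b) →
      δ ≤ dist a b → ∃ n ≤ N + 1, 2 * δ ≤ dist ((f^[k])^[n] a) ((f^[k])^[n] b) ∧
        ∀ m < n, dist ((f^[k])^[m] a) ((f^[k])^[m] b) < 2 * δ :=
    fun i σ hσ a ha b hb hab hd =>
      (hN i σ hσ a ha b hb hab hd).imp fun n hn => ⟨hn.1.trans (Nat.le_succ N), hn.2⟩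
  obtain ⟨c, hc, hgrow⟩ := exists_doubling hf hk h hδ hr hδr hN
  set P := k * (N + 1) with hP
  have hP0 : 0 < P := Nat.mul_pos hk N.succ_pos
  set R : ℝ := (2 : ℝ) ^ ((P : ℝ)⁻¹) with hR
  have hRP : R ^ P = 2 := Real.rpow_inv_natCast_pow zero_le_two hP0.ne'
  have hR1 : 1 < R := Real.one_lt_rpow one_lt_two (by positivity)
  have hRj : ∀ j : ℕ, R ^ j ≤ 2 * 2 ^ (j / P) := fun j => by
    conv_lhs => rw [← Nat.div_add_mod j P, pow_add, pow_mul, hRP, mul_comm]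
    refine mul_le_mul_of_nonneg_right ?_ (by positivity)
    rw [← hRP]
    exact pow_le_pow_right₀ hR1.le (Nat.mod_lt _ hP0).le
  refine ⟨R, hR1, fun i σ hσ γ s t hγ hne => ?_⟩
  have hs : s ∈ Icc s t := left_mem_Icc.2 hγ.le
  have ht : t ∈ Icc s t := right_mem_Icc.2 hγ.le
  obtain ⟨N', hN'⟩ := hsep _ (dist_pos.2 hne)
  obtain ⟨q, -, hq, hlt⟩ := hN' i σ hσ _ (hγ.mem_core s hs) _ (hγ.mem_core t ht)
    (hγ.ordered s hs t ht hγ.le) le_rfl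
  obtain ⟨l, τ, hτ, harc⟩ := h.exists_isOrderedArc_iterate (hf.iterate k) hr hσ hγ q
    fun m hm => (hlt m hm).trans_le hδr
  rw [← iterate_mul] at harc hq
  obtain ⟨m, hm, hd⟩ := exists_dist_left_eq hγ.le harc.continuousOn hδ.le (by
    simp only [comp_apply]
    linarith)
  -- the finitely many times before the arc has reached a definite size
  obtain ⟨c', hc', hfin⟩ := exists_pos_forall_of_finite
    (P := fun (n : Fin (k * q)) c' => c' * R ^ (n : ℕ) ≤ dist (f^[n] (γ s)) (f^[n] (γ t)))
    (fun n c₁ c₂ _ hle H => (mul_le_mul_of_nonneg_right hle (by positivity)).trans H)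
    (fun n => by
      have hpos : 0 < dist (f^[n] (γ s)) (f^[n] (γ t)) := by
        refine dist_pos.2 fun heq => ?_
        have : f^[k * q] (γ s) = f^[k * q] (γ t) := by
          rw [← Nat.sub_add_cancel n.2.le, iterate_add_apply, iterate_add_apply, heq]
        rw [this, dist_self] at hq
        linarith
      exact ⟨_, div_pos hpos (pow_pos (zero_lt_one.trans hR1) (n : ℕ)),
        (div_mul_cancel₀ _ (pow_pos (zero_lt_one.trans hR1) _).ne').le⟩)
  have hc'' : 0 < c / 2 / R ^ (k * q) := by positivity
  refine ⟨min c' (c / 2 / R ^ (k * q)), lt_min hc' hc'', fun n => ?_⟩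
  rcases Nat.lt_or_ge n (k * q) with hn | hn
  · refine le_trans ?_ (eVariationOn.edist_le (f^[n] ∘ γ) hs ht)
    rw [edist_dist]
    exact ENNReal.ofReal_le_ofReal ((mul_le_mul_of_nonneg_right (min_le_left _ _)
      (by positivity)).trans (hfin ⟨n, hn⟩))
  · obtain ⟨j, rfl⟩ := Nat.exists_eq_add_of_le' hn
    have h1 := hgrow j l τ hτ _ _ _ (harc.subarc le_rfl hm.1 hm.2) hd
    rw [← comp_assoc, ← iterate_add] at h1
    refine le_trans (ENNReal.ofReal_le_ofReal ?_)
      (h1.trans (eVariationOn.mono _ (Icc_subset_Icc le_rfl hm.2)))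
    calc min c' (c / 2 / R ^ (k * q)) * R ^ (j + k * q)
        ≤ c / 2 / R ^ (k * q) * R ^ (j + k * q) :=
          mul_le_mul_of_nonneg_right (min_le_right _ _) (by positivity)
      _ = c / 2 * R ^ j := by rw [pow_add]; field_simp
      _ ≤ c * 2 ^ (j / P) := by nlinarith [hRj j]

end IsConeAtlas

/-! ### Ordered subarcs of arcs tangent to a cone field -/

/-- A continuous injective arc, the chords of which are eventually in the horizontal cone at each
parameter, contains an ordered arc: by Baire's theorem, the chords are in the cone uniformly on
some interval, on which the first coordinate is then injective, hence monotone. -/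
lemma exists_isOrderedArc {e : OpenPartialHomeomorph M (ℝ × ℝ)} {θ : ℝ} {γ : ℝ → M}
    {s t : ℝ} (hst : s < t) (hγ : ContinuousOn γ (Icc s t)) (hinj : InjOn γ (Icc s t))
    (hcore : ∀ u ∈ Icc s t, γ u ∈ chartCore e)
    (hloc : ∀ u ∈ Icc s t, ∃ ε > 0, ∀ v ∈ Icc s t, |v - u| < ε →
      |(e (γ v)).2 - (e (γ u)).2| ≤ θ * |(e (γ v)).1 - (e (γ u)).1|) :
    ∃ s' t' σ : ℝ, s ≤ s' ∧ s' < t' ∧ t' ≤ t ∧ (σ = 1 ∨ σ = -1) ∧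
      IsOrderedArc e θ σ γ s' t' := by
  have heγ : ContinuousOn (fun u => e (γ u)) (Icc s t) := fun u hu =>
    (e.continuousAt (hcore u hu).1).comp_continuousWithinAt (hγ u hu)
  have hcont : Continuous fun u : Icc s t => e (γ u) :=
    continuousOn_iff_continuous_domRestrict.1 heγ
  let P : Icc s t → Icc s t → Prop := fun u v =>
    |(e (γ v)).2 - (e (γ u)).2| ≤ θ * |(e (γ v)).1 - (e (γ u)).1|
  let E : ℕ → Set (Icc s t) := fun n => {u | ∀ v : Icc s t, |(v : ℝ) - u| < 1 / ((n : ℝ) + 1) →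
    P u v}
  have hE : ∀ n, IsClosed (E n) := fun n => by
    have : E n = ⋂ v : Icc s t, {u : Icc s t | 1 / ((n : ℝ) + 1) ≤ |(v : ℝ) - u|} ∪ {u | P u v} := by
      ext u
      simp only [E, mem_iInter, mem_union, mem_ofPred_eq]
      exact forall_congr' fun v => by rw [← not_lt, imp_iff_not_or]
    rw [this]
    refine isClosed_iInter fun v => IsClosed.union ?_ ?_
    · exact isClosed_le continuous_const (by fun_prop)
    · exact isClosed_le (continuous_const.sub hcont.snd).abs
        ((continuous_const.sub hcont.fst).abs.const_mul θ)
  have hcov : ⋃ n, E n = univ := eq_univ_of_forall fun u => by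
    obtain ⟨ε, hε, h⟩ := hloc u u.2
    obtain ⟨n, hn⟩ := exists_nat_one_div_lt hε
    exact mem_iUnion.2 ⟨n, fun v hv => h v v.2 (hv.trans hn)⟩
  have : Nonempty (Icc s t) := ⟨⟨s, left_mem_Icc.2 hst.le⟩⟩
  have : CompleteSpace (Icc s t) := isClosed_Icc.completeSpace_coe
  obtain ⟨n, ⟨w, hw⟩, hwE⟩ := nonempty_interior_of_iUnion_of_closed hE hcov
  obtain ⟨η, hη, hball⟩ := Metric.mem_nhds_iff.1 (mem_interior_iff_mem_nhds.1 hwE)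
  have hn0 : 0 < 1 / ((n : ℝ) + 1) := by positivity
  obtain ⟨η', hη'0, hη'⟩ := exists_between (lt_min hη hn0)
  obtain ⟨h1, h2⟩ := lt_min_iff.1 hη'
  have hlt : max s (w - η' / 2) < min t (w + η' / 2) :=
    max_lt (lt_min hst (by linarith [hw.1])) (lt_min (by linarith [hw.2]) (by linarith))
  have hsub : Icc (max s (w - η' / 2)) (min t (w + η' / 2)) ⊆ Icc s t :=
    Icc_subset_Icc (le_max_left _ _) (min_le_left _ _)
  have hcone : ∀ u ∈ Icc (max s (w - η' / 2)) (min t (w + η' / 2)),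
      ∀ v ∈ Icc (max s (w - η' / 2)) (min t (w + η' / 2)),
      |(e (γ v)).2 - (e (γ u)).2| ≤ θ * |(e (γ v)).1 - (e (γ u)).1| := by
    intro u hu v hv
    have hu1 := (le_max_right _ _).trans hu.1
    have hu2 := hu.2.trans (min_le_right _ _)
    have hv1 := (le_max_right _ _).trans hv.1
    have hv2 := hv.2.trans (min_le_right _ _)
    have huE : (⟨u, hsub hu⟩ : Icc s t) ∈ E n := hball (by
      rw [Metric.mem_ball, Subtype.dist_eq, Real.dist_eq, abs_lt]
      constructor <;> linarith)
    refine huE ⟨v, hsub hv⟩ ?_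
    rw [abs_lt]
    constructor <;> linarith
  have hinj' : InjOn (fun u => (e (γ u)).1) (Icc (max s (w - η' / 2)) (min t (w + η' / 2))) := by
    intro u hu v hv huv
    have huv1 : (e (γ u)).1 = (e (γ v)).1 := huv
    have := hcone u hu v hv
    rw [huv1, sub_self, abs_zero, mul_zero] at this
    have huv2 := sub_eq_zero.1 (abs_nonpos_iff.1 this)
    exact hinj (hsub hu) (hsub hv) (e.injOn (hcore u (hsub hu)).1 (hcore v (hsub hv)).1
      (Prod.ext huv1 huv2.symm))
  have hx : ContinuousOn (fun u => (e (γ u)).1)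
      (Icc (max s (w - η' / 2)) (min t (w + η' / 2))) :=
    continuous_fst.comp_continuousOn (heγ.mono hsub)
  have harc : ∀ σ : ℝ, (∀ u ∈ Icc (max s (w - η' / 2)) (min t (w + η' / 2)),
      ∀ v ∈ Icc (max s (w - η' / 2)) (min t (w + η' / 2)), u ≤ v →
      |(e (γ v)).1 - (e (γ u)).1| = σ * ((e (γ v)).1 - (e (γ u)).1)) →
      IsOrderedArc e θ σ γ (max s (w - η' / 2)) (min t (w + η' / 2)) := fun σ h =>
    ⟨hlt.le, hγ.mono hsub, fun u hu => hcore u (hsub hu), fun u hu v hv huv => by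
      have := hcone u hu v hv
      rwa [h u hu v hv huv] at this⟩
  rcases hx.strictMonoOn_of_injOn_Icc' hlt.le hinj' with hmono | hanti
  · refine ⟨_, _, 1, le_max_left _ _, hlt, min_le_left _ _, Or.inl rfl,
      harc 1 fun u hu v hv huv => ?_⟩
    rw [one_mul, abs_of_nonneg]
    exact sub_nonneg.2 (hmono.monotoneOn hu hv huv)
  · refine ⟨_, _, -1, le_max_left _ _, hlt, min_le_left _ _, Or.inr rfl,
      harc (-1) fun u hu v hv huv => ?_⟩
    rw [abs_of_nonpos (sub_nonpos.2 (hanti.antitoneOn hu hv huv)), neg_one_mul]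

end Growth

/-! ### Cones in the plane -/

section PlaneCones

/-- The Euclidean plane. -/
local notation "𝔼" => EuclideanSpace ℝ (Fin 2)

/-- The determinant of two vectors of the plane. -/
def planeDet (u v : 𝔼) : ℝ := u 0 * v 1 - u 1 * v 0

lemma planeDet_smul (u v w : 𝔼) :
    planeDet u v • w = planeDet w v • u + planeDet u w • v := by
  ext i
  fin_cases i <;> simp [planeDet] <;> ring

lemma exists_eq_smul_of_planeDet_eq_zero {u v : 𝔼} (hu : u ≠ 0) (h : planeDet u v = 0) :
    ∃ c : ℝ, v = c • u := by
  have hw : planeDet u !₂[-u 1, u 0] ≠ 0 := by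
    intro h0
    simp only [planeDet, Matrix.cons_val_one, Matrix.cons_val_zero] at h0
    refine hu ?_
    ext i
    fin_cases i
    · simp only [Fin.zero_eta, PiLp.zero_apply]; nlinarith [sq_nonneg (u 0), sq_nonneg (u 1)]
    · simp only [Fin.mk_one, PiLp.zero_apply]; nlinarith [sq_nonneg (u 0), sq_nonneg (u 1)]
  have := planeDet_smul u v !₂[-u 1, u 0]
  rw [h, zero_smul] at this
  refine ⟨-(planeDet u !₂[-u 1, u 0])⁻¹ * planeDet !₂[-u 1, u 0] v, ?_⟩
  rw [mul_smul, neg_smul, ← smul_neg, eq_neg_of_add_eq_zero_left this.symm, neg_neg,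
    inv_smul_smul₀ hw]

section General

variable {V W : Type*} [AddCommGroup V] [Module ℝ V] [TopologicalSpace V] [AddCommGroup W]
  [Module ℝ W] [TopologicalSpace W]

lemma IsClosedConvexCone.add_mem {K : Set V} (hK : IsClosedConvexCone K) {v w : V} (hv : v ∈ K)
    (hw : w ∈ K) : v + w ∈ K := by
  have := hK.smul_mem 2 zero_le_two _
    (hK.convex hv hw (by norm_num : (0 : ℝ) ≤ 1 / 2) (by norm_num : (0 : ℝ) ≤ 1 / 2) (by norm_num))
  rw [← smul_add, smul_smul] at this
  simpa using this

lemma IsClosedConvexCone.zero_mem {K : Set V} (hK : IsClosedConvexCone K) : (0 : V) ∈ K := by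
  obtain ⟨v, hv, -⟩ := hK.nontrivial
  simpa using hK.smul_mem 0 le_rfl v hv

lemma IsClosedConvexCone.preimage {K : Set V} (hK : IsClosedConvexCone K) (Φ : W ≃L[ℝ] V) :
    IsClosedConvexCone (Φ ⁻¹' K) where
  isClosed := hK.isClosed.preimage Φ.continuous
  convex := hK.convex.linear_preimage Φ.toLinearMap
  smul_mem c hc v hv := by simpa using hK.smul_mem c hc _ hv
  nontrivial := by
    obtain ⟨v, hv, h0⟩ := hK.nontrivial
    exact ⟨Φ.symm v, by simpa using hv, by simpa using h0⟩
  salient v hv hv' := by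
    have := hK.salient (Φ v) hv (by simpa using hv')
    simpa using this

lemma IsCone.preimage {S : Set V} (hS : IsCone S) (Φ : W ≃L[ℝ] V) : IsCone (Φ ⁻¹' S) := by
  obtain ⟨K, hK, h⟩ := hS
  refine ⟨Φ ⁻¹' K, hK.preimage Φ, ?_⟩
  rcases h with rfl | rfl
  · exact Or.inl rfl
  · refine Or.inr ?_
    ext v
    simp

lemma IsCone.smul_mem {S : Set V} (hS : IsCone S) {c : ℝ} (hc : 0 ≤ c) {v : V} (hv : v ∈ S) :
    c • v ∈ S := by
  obtain ⟨K, hK, rfl | rfl⟩ := hS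
  · exact hK.smul_mem c hc v hv
  · refine hv.imp (hK.smul_mem c hc v) fun h => ?_
    rw [← smul_neg]
    exact hK.smul_mem c hc _ h

end General

lemma IsClosedConvexCone.exists_nonneg_functional {K : Set 𝔼} (hK : IsClosedConvexCone K) {w : 𝔼}
    (hw : w ∈ K) (hw0 : w ≠ 0) : ∃ f : 𝔼 →L[ℝ] ℝ, (∀ v ∈ K, 0 ≤ f v) ∧ 0 < f w := by
  obtain ⟨f, u, h1, h2⟩ := geometric_hahn_banach_point_closed hK.convex hK.isClosed
    (x := -w) fun h => hw0 (hK.salient w hw h)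
  have hu : u < 0 := by simpa using h2 0 hK.zero_mem
  refine ⟨f, fun v hv => ?_, ?_⟩
  · by_contra! hneg
    have := h2 _ (hK.smul_mem (u / f v) (div_pos_of_neg_of_neg hu hneg).le v hv)
    rw [map_smul, smul_eq_mul, div_mul_cancel₀ _ hneg.ne] at this
    exact lt_irrefl _ this
  · rw [map_neg] at h1
    linarith

/-- A closed convex cone in the plane which contains no line lies in an open half-plane. -/
lemma IsClosedConvexCone.exists_pos_functional {K : Set 𝔼} (hK : IsClosedConvexCone K) :
    ∃ α : 𝔼 →L[ℝ] ℝ, ∀ v ∈ K, v ≠ 0 → 0 < α v := by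
  obtain ⟨v₀, hv₀, h₀⟩ := hK.nontrivial
  obtain ⟨f, hf, hf0⟩ := hK.exists_nonneg_functional hv₀ h₀
  by_cases h : ∃ w ∈ K, w ≠ 0 ∧ f w = 0
  · obtain ⟨w, hw, hw0, hfw⟩ := h
    obtain ⟨g, hg, hg0⟩ := hK.exists_nonneg_functional hw hw0
    refine ⟨f + g, fun v hv hv0 => ?_⟩
    rcases (hf v hv).lt_or_eq with hpos | hzero
    · exact add_pos_of_pos_of_nonneg hpos (hg v hv)
    · -- `v` lies on the boundary line spanned by `w`
      have hdet : planeDet w v = 0 := by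
        have := congrArg f (planeDet_smul w v v₀)
        simp only [map_smul, map_add, hfw, ← hzero, smul_eq_mul, mul_zero, add_zero] at this
        exact (mul_eq_zero.1 this).resolve_right hf0.ne'
      obtain ⟨c, rfl⟩ := exists_eq_smul_of_planeDet_eq_zero hw0 hdet
      refine add_pos_of_nonneg_of_pos (hf _ hv) ((hg _ hv).lt_of_ne fun h0 => hv0 ?_)
      rw [map_smul, smul_eq_mul] at h0
      rw [(mul_eq_zero.1 h0.symm).resolve_right hg0.ne', zero_smul]
  · push Not at h
    exact ⟨f, fun v hv hv0 => (hf v hv).lt_of_ne (h v hv hv0).symm⟩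

/-- In suitable linear coordinates, a cone in the plane and its opposite are the horizontal cone of
some slope `h`; the slope vanishes if the cone is a ray or a line. -/
lemma IsCone.exists_coordinates {S : Set 𝔼} (hS : IsCone S) :
    ∃ L : 𝔼 ≃L[ℝ] ℝ × ℝ, ∃ h : ℝ, 0 ≤ h ∧
      ∀ v, (v ∈ S ∨ -v ∈ S) ↔ |(L v).2| ≤ h * |(L v).1| := by
  obtain ⟨K, hK, hSK⟩ := hS
  have hred : ∀ v, (v ∈ S ∨ -v ∈ S) ↔ (v ∈ K ∨ -v ∈ K) := fun v => by
    rcases hSK with rfl | rfl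
    · rfl
    · simp only [mem_ofPred_eq, neg_neg]
      tauto
  obtain ⟨α, hα⟩ := hK.exists_pos_functional
  obtain ⟨v₀, hv₀, h₀⟩ := hK.nontrivial
  let β₀ : 𝔼 →L[ℝ] ℝ := v₀ 0 • EuclideanSpace.proj 1 - v₀ 1 • EuclideanSpace.proj 0
  have hβ₀ : ∀ v, β₀ v = planeDet v₀ v := fun v => by simp [β₀, planeDet]
  have hinj : ∀ v, α v = 0 → β₀ v = 0 → v = 0 := fun v h1 h2 => by
    obtain ⟨c, rfl⟩ := exists_eq_smul_of_planeDet_eq_zero h₀ ((hβ₀ v).symm.trans h2)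
    rw [map_smul, smul_eq_mul] at h1
    rw [(mul_eq_zero.1 h1).resolve_right (hα v₀ hv₀ h₀).ne', zero_smul]
  -- the slopes `β₀ v / α v` of the vectors of the cone fill a compact interval
  have hcomp : IsCompact (K ∩ Metric.sphere 0 1) := (isCompact_sphere 0 1).inter_left hK.isClosed
  have hne : (K ∩ Metric.sphere 0 1).Nonempty :=
    ⟨‖v₀‖⁻¹ • v₀, hK.smul_mem _ (by positivity) _ hv₀, by simp [norm_smul, h₀]⟩
  have hne0 : ∀ v ∈ K ∩ Metric.sphere (0 : 𝔼) 1, v ≠ 0 := fun v hv => by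
    rintro rfl
    simpa using hv.2
  have hcont : ContinuousOn (fun v => β₀ v / α v) (K ∩ Metric.sphere 0 1) :=
    β₀.continuous.continuousOn.div α.continuous.continuousOn
      fun v hv => (hα v hv.1 (hne0 v hv)).ne'
  obtain ⟨v₁, hv₁, hmin⟩ := hcomp.exists_isMinOn hne hcont
  obtain ⟨v₂, hv₂, hmax⟩ := hcomp.exists_isMaxOn hne hcont
  set m₁ := β₀ v₁ / α v₁ with hm₁
  set m₂ := β₀ v₂ / α v₂ with hm₂
  have hα₁ := hα v₁ hv₁.1 (hne0 v₁ hv₁)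
  have hα₂ := hα v₂ hv₂.1 (hne0 v₂ hv₂)
  have hβ₁ : β₀ v₁ = m₁ * α v₁ := by rw [hm₁]; field_simp
  have hβ₂ : β₀ v₂ = m₂ * α v₂ := by rw [hm₂]; field_simp
  have hm : m₁ ≤ m₂ := hmin hv₂
  have hslope : ∀ v ∈ K, m₁ * α v ≤ β₀ v ∧ β₀ v ≤ m₂ * α v := fun v hv => by
    rcases eq_or_ne v 0 with rfl | hv0
    · simp
    have hαv := hα v hv hv0
    have hn : 0 < ‖v‖⁻¹ := inv_pos.2 (norm_pos_iff.2 hv0)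
    have hmem : ‖v‖⁻¹ • v ∈ K ∩ Metric.sphere 0 1 :=
      ⟨hK.smul_mem _ hn.le _ hv, by simp [norm_smul, hv0]⟩
    have h1 : m₁ ≤ β₀ (‖v‖⁻¹ • v) / α (‖v‖⁻¹ • v) := hmin hmem
    have h2 : β₀ (‖v‖⁻¹ • v) / α (‖v‖⁻¹ • v) ≤ m₂ := hmax hmem
    rw [map_smul, map_smul, smul_eq_mul, smul_eq_mul, mul_div_mul_left _ _ hn.ne'] at h1 h2
    exact ⟨(le_div_iff₀ hαv).1 h1, (div_le_iff₀ hαv).1 h2⟩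
  have hconv : ∀ v, 0 ≤ α v → m₁ * α v ≤ β₀ v → β₀ v ≤ m₂ * α v → v ∈ K := by
    intro v h0 h1 h2
    rcases hm.eq_or_lt with heq | hlt
    · have : v = (α v / α v₁) • v₁ := by
        refine sub_eq_zero.1 (hinj _ ?_ ?_)
        · rw [map_sub, map_smul, smul_eq_mul, div_mul_cancel₀ _ hα₁.ne', sub_self]
        · rw [map_sub, map_smul, smul_eq_mul, hβ₁]
          field_simp
          rw [← heq] at h2
          linarith
      rw [this]
      exact hK.smul_mem _ (by positivity) _ hv₁.1
    · have hd : 0 < m₂ - m₁ := sub_pos.2 hlt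
      have : v = ((m₂ * α v - β₀ v) / (m₂ - m₁) / α v₁) • v₁ +
          ((β₀ v - m₁ * α v) / (m₂ - m₁) / α v₂) • v₂ := by
        refine sub_eq_zero.1 (hinj _ ?_ ?_)
        · simp only [map_sub, map_add, map_smul, smul_eq_mul]
          field_simp
          ring
        · simp only [map_sub, map_add, map_smul, smul_eq_mul, hβ₁, hβ₂]
          field_simp
          ring
      rw [this]
      exact hK.add_mem
        (hK.smul_mem _ (div_nonneg (div_nonneg (by linarith) hd.le) hα₁.le) _ hv₁.1)
        (hK.smul_mem _ (div_nonneg (div_nonneg (by linarith) hd.le) hα₂.le) _ hv₂.1)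
  let β : 𝔼 →L[ℝ] ℝ := β₀ - ((m₁ + m₂) / 2) • α
  have hβ : ∀ v, β v = β₀ v - (m₁ + m₂) / 2 * α v := fun v => by simp [β]
  have hinj' : Injective (α.prod β) := by
    refine (injective_iff_map_eq_zero _).2 fun v hv => ?_
    have h1 : α v = 0 := congrArg Prod.fst hv
    have h2 : β v = 0 := congrArg Prod.snd hv
    rw [hβ, h1, mul_zero, sub_zero] at h2
    exact hinj v h1 h2
  refine ⟨(LinearEquiv.ofInjectiveOfFinrankEq (α.prod β).toLinearMap hinj'
    (by simp)).toContinuousLinearEquiv, (m₂ - m₁) / 2, by linarith, fun v => ?_⟩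
  change (v ∈ S ∨ -v ∈ S) ↔ |β v| ≤ (m₂ - m₁) / 2 * |α v|
  rw [hred, hβ, abs_le]
  constructor
  · rintro (hv | hv)
    · obtain ⟨h1, h2⟩ := hslope v hv
      have h0 : 0 ≤ α v := by
        rcases eq_or_ne v 0 with rfl | hv0
        · simp
        · exact (hα v hv hv0).le
      rw [abs_of_nonneg h0]
      constructor <;> linarith
    · obtain ⟨h1, h2⟩ := hslope _ hv
      have h0 : 0 ≤ α (-v) := by
        rcases eq_or_ne (-v) 0 with hz | hv0
        · simp [hz]
        · exact (hα _ hv hv0).le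
      rw [map_neg] at h0 h1 h2
      rw [map_neg] at h1 h2
      rw [abs_of_nonpos (by linarith)]
      constructor <;> linarith
  · rintro ⟨h1, h2⟩
    rcases le_total 0 (α v) with h0 | h0
    · rw [abs_of_nonneg h0] at h1 h2
      exact Or.inl (hconv v h0 (by linarith) (by linarith))
    · rw [abs_of_nonpos h0] at h1 h2
      refine Or.inr (hconv _ ?_ ?_ ?_) <;> rw [map_neg] <;> try rw [map_neg]
      all_goals linarith

/-! ### Continuous families of cones in the plane -/

section Families

variable {X : Type*} [TopologicalSpace X] {c : X → Set 𝔼} {x₀ : X}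

/-- Upper semicontinuity: near `x₀`, the cones are contained in wider cones. -/
lemma eventually_cone_subset (hcone : ∀ᶠ x in 𝓝 x₀, IsCone (c x))
    (hcl : ∀ u ∉ c x₀, ∀ᶠ z in 𝓝 (x₀, u), z.2 ∉ c z.1) {L : 𝔼 ≃L[ℝ] ℝ × ℝ} {h h' : ℝ}
    (hh' : h < h') (hL : ∀ v ∈ c x₀, |(L v).2| ≤ h * |(L v).1|) :
    ∀ᶠ x in 𝓝 x₀, ∀ v ∈ c x, v ≠ 0 → |(L v).2| < h' * |(L v).1| := by
  have hsphere : ∀ᶠ x in 𝓝 x₀, ∀ v ∈ Metric.sphere (0 : 𝔼) 1,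
      v ∈ c x → |(L v).2| < h' * |(L v).1| := by
    refine (isCompact_sphere _ _).eventually_forall_of_forall_eventually fun v hv => ?_
    by_cases hvc : v ∈ c x₀
    · have hstrict : |(L v).2| < h' * |(L v).1| := by
        have h1 := hL v hvc
        refine h1.trans_lt (mul_lt_mul_of_pos_right hh' (abs_pos.2 fun h0 => ?_))
        rw [h0, abs_zero, mul_zero] at h1
        have : L v = 0 := Prod.ext h0 (abs_nonpos_iff.1 h1)
        rw [map_eq_zero_iff L L.injective] at this
        simp [this] at hv
      have hc1 : Continuous fun z : X × 𝔼 => |(L z.2).2| := by fun_prop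
      have hc2 : Continuous fun z : X × 𝔼 => h' * |(L z.2).1| := by fun_prop
      filter_upwards [(isOpen_lt hc1 hc2).mem_nhds hstrict] with z hz _ using hz
    · filter_upwards [hcl v hvc] with z hz hz' using absurd hz' hz
  filter_upwards [hcone, hsphere] with x hx hS v hv hv0
  have hn : 0 < ‖v‖⁻¹ := inv_pos.2 (norm_pos_iff.2 hv0)
  have := hS (‖v‖⁻¹ • v) (by simp [norm_smul, hv0]) (hx.smul_mem hn.le hv)
  rw [map_smul, Prod.smul_fst, Prod.smul_snd, smul_eq_mul, smul_eq_mul, abs_mul, abs_mul,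
    mul_left_comm] at this
  exact lt_of_mul_lt_mul_left this (abs_nonneg _)

/-- Lower semicontinuity: an interior vector of the cone at `x₀` belongs, together with all nearby
vectors, to the cones at all nearby points, up to sign. Indeed it is a positive combination of two
vectors `w₁`, `w₂` of the cone, hence of nearby vectors of a nearby cone; these lie in the same half
of that cone since `w₁ - w₂` may be chosen outside of the cone at `x₀`. -/
lemma eventually_mem_cone (hcone : ∀ᶠ x in 𝓝 x₀, IsCone (c x))
    (hcl : ∀ u ∉ c x₀, ∀ᶠ z in 𝓝 (x₀, u), z.2 ∉ c z.1)
    (hlsc : ∀ u ∈ c x₀, ∀ N ∈ 𝓝 u, ∀ᶠ x in 𝓝 x₀, ∃ w ∈ N, w ∈ c x) {u₀ : 𝔼}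
    (hu₀ : u₀ ∈ interior (c x₀)) (hne : u₀ ≠ 0) :
    ∀ᶠ z in 𝓝 (x₀, u₀), z.2 ∈ c z.1 ∨ -z.2 ∈ c z.1 := by
  obtain ⟨L, h, hh, hL⟩ := hcone.self_of_nhds.exists_coordinates
  set t : 𝔼 := L.symm (0, 1) with ht
  have hLt : ∀ a : ℝ, L (a • t) = (0, a) := fun a => by
    rw [map_smul, ht, ContinuousLinearEquiv.apply_symm_apply]
    simp
  have htc : ∀ a : ℝ, a ≠ 0 → ¬ (a • t ∈ c x₀ ∨ -(a • t) ∈ c x₀) := fun a ha hmem => by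
    rw [hL, hLt] at hmem
    simp only [abs_zero, mul_zero] at hmem
    exact ha (abs_nonpos_iff.1 hmem)
  have hdet : planeDet u₀ t ≠ 0 := fun h0 => by
    obtain ⟨a, ha⟩ := exists_eq_smul_of_planeDet_eq_zero hne h0
    have h1 := (hL u₀).1 (Or.inl (interior_subset hu₀))
    have h2 : L t = a • L u₀ := by rw [ha, map_smul]
    have h3 := hLt 1
    rw [one_smul, h2] at h3
    have h4 : a * (L u₀).1 = 0 := congrArg Prod.fst h3
    have h5 : a * (L u₀).2 = 1 := congrArg Prod.snd h3
    have ha0 : a ≠ 0 := by rintro rfl; simp at h5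
    rw [(mul_eq_zero.1 h4).resolve_left ha0, abs_zero, mul_zero] at h1
    rw [abs_nonpos_iff.1 h1, mul_zero] at h5
    exact zero_ne_one h5
  -- two vectors of the cone on both sides of `u₀`
  obtain ⟨ε, ⟨hε1, hε2⟩, hε⟩ : ∃ ε : ℝ, (u₀ + ε • t ∈ c x₀ ∧ u₀ - ε • t ∈ c x₀) ∧ 0 < ε := by
    have h1 : Tendsto (fun ε : ℝ => u₀ + ε • t) (𝓝 0) (𝓝 u₀) := by
      have : Continuous fun ε : ℝ => u₀ + ε • t := by fun_prop
      simpa using this.tendsto 0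
    have h2 : Tendsto (fun ε : ℝ => u₀ - ε • t) (𝓝 0) (𝓝 u₀) := by
      have : Continuous fun ε : ℝ => u₀ - ε • t := by fun_prop
      simpa using this.tendsto 0
    have hn := mem_interior_iff_mem_nhds.1 hu₀
    have := (((h1.eventually hn).and (h2.eventually hn)).filter_mono
      (nhdsWithin_le_nhds (s := Ioi (0 : ℝ)))).and self_mem_nhdsWithin
    exact this.exists
  set w₁ := u₀ + ε • t with hw₁
  set w₂ := u₀ - ε • t with hw₂
  have hsub : w₁ - w₂ = (2 * ε) • t := by rw [hw₁, hw₂]; module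
  have hnot : ¬ (w₁ - w₂ ∈ c x₀ ∨ -(w₁ - w₂) ∈ c x₀) := by
    rw [hsub]
    exact htc _ (by positivity)
  push Not at hnot
  have hd12 : planeDet w₁ w₂ = -2 * ε * planeDet u₀ t := by
    simp [planeDet, hw₁, hw₂]; ring
  have hd02 : planeDet u₀ w₂ = -ε * planeDet u₀ t := by
    simp [planeDet, hw₂]; ring
  have hd10 : planeDet w₁ u₀ = -ε * planeDet u₀ t := by
    simp [planeDet, hw₁]; ring
  have hdcont : Continuous fun p : 𝔼 × 𝔼 => planeDet p.1 p.2 := by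
    unfold planeDet
    fun_prop
  have hgood : ∀ᶠ q : (𝔼 × 𝔼) × X × 𝔼 in 𝓝 (w₁, w₂) ×ˢ 𝓝 (x₀, u₀),
      0 < planeDet q.2.2 q.1.2 * planeDet q.1.1 q.1.2 ∧
      0 < planeDet q.1.1 q.2.2 * planeDet q.1.1 q.1.2 ∧
      q.1.1 - q.1.2 ∉ c q.2.1 ∧ -(q.1.1 - q.1.2) ∉ c q.2.1 := by
    rw [← nhds_prod_eq]
    have hpos : 0 < ε * planeDet u₀ t * (2 * ε * planeDet u₀ t) := by
      have := mul_self_pos.2 hdet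
      nlinarith [mul_pos (mul_pos hε hε) this]
    refine Eventually.and ?_ (Eventually.and ?_ (Eventually.and ?_ ?_))
    · have hc : Continuous fun q : (𝔼 × 𝔼) × X × 𝔼 =>
          planeDet q.2.2 q.1.2 * planeDet q.1.1 q.1.2 :=
        (hdcont.comp (by fun_prop : Continuous fun q : (𝔼 × 𝔼) × X × 𝔼 => (q.2.2, q.1.2))).mul
          (hdcont.comp (by fun_prop : Continuous fun q : (𝔼 × 𝔼) × X × 𝔼 => (q.1.1, q.1.2)))
      refine (isOpen_lt continuous_const hc).mem_nhds ?_
      change 0 < planeDet u₀ w₂ * planeDet w₁ w₂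
      rw [hd02, hd12]
      linarith
    · have hc : Continuous fun q : (𝔼 × 𝔼) × X × 𝔼 =>
          planeDet q.1.1 q.2.2 * planeDet q.1.1 q.1.2 :=
        (hdcont.comp (by fun_prop : Continuous fun q : (𝔼 × 𝔼) × X × 𝔼 => (q.1.1, q.2.2))).mul
          (hdcont.comp (by fun_prop : Continuous fun q : (𝔼 × 𝔼) × X × 𝔼 => (q.1.1, q.1.2)))
      refine (isOpen_lt continuous_const hc).mem_nhds ?_
      change 0 < planeDet w₁ u₀ * planeDet w₁ w₂
      rw [hd10, hd12]
      linarith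
    · have hc : Continuous fun q : (𝔼 × 𝔼) × X × 𝔼 => (q.2.1, q.1.1 - q.1.2) := by fun_prop
      exact (hc.tendsto ((w₁, w₂), x₀, u₀)).eventually (hcl _ hnot.1)
    · have hc : Continuous fun q : (𝔼 × 𝔼) × X × 𝔼 => (q.2.1, -(q.1.1 - q.1.2)) := by fun_prop
      exact (hc.tendsto ((w₁, w₂), x₀, u₀)).eventually (hcl _ hnot.2)
  obtain ⟨pa, hpa, pb, hpb, hab⟩ := eventually_prod_iff.1 hgood
  obtain ⟨N₁, hN₁, N₂, hN₂, hN⟩ := mem_nhds_prod_iff.1 hpa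
  have hex := (hcone.and ((hlsc w₁ hε1 N₁ hN₁).and (hlsc w₂ hε2 N₂ hN₂))).prod_inl_nhds u₀
  filter_upwards [hpb, hex]
  rintro ⟨x, u⟩ hz ⟨⟨K, hK, hKc⟩, ⟨u₁, hu₁, hu₁c⟩, u₂, hu₂, hu₂c⟩
  obtain ⟨hs1, hs2, hn1, hn2⟩ := hab (hN (mk_mem_prod hu₁ hu₂)) hz
  simp only at *
  have hd : planeDet u₁ u₂ ≠ 0 := fun h0 => by simp [h0] at hs1
  have hd2 : 0 < (planeDet u₁ u₂)⁻¹ * (planeDet u₁ u₂)⁻¹ := mul_self_pos.2 (inv_ne_zero hd)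
  have hu : u = (planeDet u u₂ / planeDet u₁ u₂) • u₁ +
      (planeDet u₁ u / planeDet u₁ u₂) • u₂ := by
    rw [div_eq_inv_mul, div_eq_inv_mul, mul_smul, mul_smul, ← smul_add, ← planeDet_smul,
      inv_smul_smul₀ hd]
  have hs1' : 0 ≤ planeDet u u₂ / planeDet u₁ u₂ := by
    have := mul_pos hs1 hd2
    field_simp at this
    exact this.le
  have hs2' : 0 ≤ planeDet u₁ u / planeDet u₁ u₂ := by
    have := mul_pos hs2 hd2
    field_simp at this
    exact this.le
  have hsubset : K ⊆ c x := by
    rcases hKc with h | h <;> rw [h]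
    exact fun v hv => Or.inl hv
  have hcases : ∀ v ∈ c x, v ∈ K ∨ -v ∈ K := fun v hv => by
    rcases hKc with h | h <;> rw [h] at hv
    exacts [Or.inl hv, hv]
  rcases hcases _ hu₁c with h1 | h1 <;> rcases hcases _ hu₂c with h2 | h2
  · refine Or.inl (hsubset ?_)
    rw [hu]
    exact hK.add_mem (hK.smul_mem _ hs1' _ h1) (hK.smul_mem _ hs2' _ h2)
  · exact absurd (hsubset (by simpa [sub_eq_add_neg] using hK.add_mem h1 h2)) hn1
  · refine absurd (hsubset ?_) hn2
    rw [neg_sub, sub_eq_add_neg]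
    exact hK.add_mem h2 h1
  · refine Or.inr (hsubset ?_)
    rw [hu, neg_add, ← smul_neg, ← smul_neg]
    exact hK.add_mem (hK.smul_mem _ hs1' _ h1) (hK.smul_mem _ hs2' _ h2)

end Families

end PlaneCones

/-! ### Charts adapted to a cone field on a surface -/

section AdaptedCharts

/-- The Euclidean plane. -/
local notation "𝔼" => EuclideanSpace ℝ (Fin 2)

variable {M : Type*} [TopologicalSpace M] [ChartedSpace (EuclideanSpace ℝ (Fin 2)) M]
  [IsManifold (𝓡 2) 1 M]

/-- The trivialization of the tangent bundle over the chart at `x`. -/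
local notation "τ" => trivializationAt (EuclideanSpace ℝ (Fin 2))
  (TangentSpace (𝓡 2) : M → Type _)

/-- The cone at `p` of a cone field, in the coordinates of the chart at `x`. -/
def coneIn (C : ∀ x : M, Set (TangentSpace (𝓡 2) x)) (x p : M) : Set 𝔼 :=
  (τ x).symmL ℝ p ⁻¹' C p

variable {C : ∀ x : M, Set (TangentSpace (𝓡 2) x)} {F : M → M} {x p : M}

lemma mem_trivializationAt_baseSet (hp : p ∈ (chartAt 𝔼 x).source) : p ∈ (τ x).baseSet := by
  rwa [TangentBundle.trivializationAt_baseSet]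

lemma continuousAt_mk_symmL (hp : p ∈ (chartAt 𝔼 x).source) (u : 𝔼) :
    ContinuousAt (fun z : M × 𝔼 => (⟨z.1, (τ x).symmL ℝ z.1 z.2⟩ : TangentBundle (𝓡 2) M))
      (p, u) := by
  have hb : (τ x).baseSet ∈ 𝓝 p :=
    (τ x).open_baseSet.mem_nhds (mem_trivializationAt_baseSet hp)
  have h := (τ x).continuousOn_symm.continuousAt (x := (p, u)) (prod_mem_nhds hb univ_mem)
  refine h.congr ?_
  filter_upwards [prod_mem_nhds hb univ_mem] with z hz
  rw [Trivialization.symmL_apply (R := ℝ) _ hz.1]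

lemma isCone_coneIn (hC : IsContinuousConeField C) (hp : p ∈ (chartAt 𝔼 x).source) :
    IsCone (coneIn C x p) := by
  have h := (hC.isCone p).preimage
    ((τ x).continuousLinearEquivAt ℝ p (mem_trivializationAt_baseSet hp)).symm
  rw [Trivialization.symm_continuousLinearEquivAt_eq] at h
  exact h

lemma eventually_notMem_coneIn (hC : IsContinuousConeField C)
    (hp : p ∈ (chartAt 𝔼 x).source) {u : 𝔼} (hu : u ∉ coneIn C x p) :
    ∀ᶠ z in 𝓝 (p, u), z.2 ∉ coneIn C x z.1 :=
  (continuousAt_mk_symmL hp u).tendsto.eventually (hC.isClosed.isOpen_compl.mem_nhds hu)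

lemma eventually_exists_mem_coneIn (hC : IsContinuousConeField C)
    (hp : p ∈ (chartAt 𝔼 x).source) {u : 𝔼} (hu : u ∈ coneIn C x p) {N : Set 𝔼} (hN : N ∈ 𝓝 u) :
    ∀ᶠ q in 𝓝 p, ∃ w ∈ N, w ∈ coneIn C x q := by
  have hb := mem_trivializationAt_baseSet hp
  have hopen : IsOpen ((τ x).source ∩ τ x ⁻¹' (univ ×ˢ interior N)) :=
    (τ x).toOpenPartialHomeomorph.isOpen_inter_preimage (isOpen_univ.prod isOpen_interior)
  have happ : ∀ q ∈ (τ x).baseSet, ∀ v : TangentSpace (𝓡 2) q,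
      (τ x ⟨q, v⟩).2 = (τ x).continuousLinearMapAt ℝ q v := fun q hq v => by
    rw [Trivialization.continuousLinearMapAt_apply, Trivialization.coe_linearMapAt_of_mem _ hq]
  have hmem := (hC.isOpen _ hopen).mem_nhds (x := p) ⟨(τ x).symmL ℝ p u, hu,
    (τ x).mem_source.2 hb, mem_univ _, by
      rw [happ p hb, Trivialization.continuousLinearMapAt_symmL _ hb]
      exact mem_interior_iff_mem_nhds.2 hN⟩
  filter_upwards [hmem, (τ x).open_baseSet.mem_nhds hb]
  rintro q ⟨v, hv, -, -, hvN⟩ hq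
  refine ⟨(τ x).continuousLinearMapAt ℝ q v, ?_, ?_⟩
  · rw [happ q hq] at hvN
    exact interior_subset hvN
  · change (τ x).symmL ℝ q _ ∈ C q
    rwa [Trivialization.symmL_continuousLinearMapAt _ hq]

/-- Near a vector of the cone at `x`, the derivative of `F` takes values in the two-sided cone
field. -/
lemma eventually_mfderiv_mem_cone (hC : IsContinuousConeField C) (hF : ContMDiff (𝓡 2) (𝓡 2) 1 F)
    (hinv : ∀ v ∈ C x, mfderiv (𝓡 2) (𝓡 2) F x v ∈ insert 0 (interior (C (F x))))
    (hker : ∀ v ∈ C x, mfderiv (𝓡 2) (𝓡 2) F x v = 0 → v = 0) {u : 𝔼}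
    (hu : u ∈ coneIn C x x) (hu0 : u ≠ 0) :
    ∀ᶠ z in 𝓝 (x, u), mfderiv (𝓡 2) (𝓡 2) F z.1 ((τ x).symmL ℝ z.1 z.2) ≠ 0 ∧
      (mfderiv (𝓡 2) (𝓡 2) F z.1 ((τ x).symmL ℝ z.1 z.2) ∈ C (F z.1) ∨
        -mfderiv (𝓡 2) (𝓡 2) F z.1 ((τ x).symmL ℝ z.1 z.2) ∈ C (F z.1)) := by
  have hx : x ∈ (chartAt 𝔼 x).source := mem_chart_source _ x
  have hy : F x ∈ (chartAt 𝔼 (F x)).source := mem_chart_source _ (F x)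
  have hxb := mem_trivializationAt_baseSet hx
  have hyb := mem_trivializationAt_baseSet hy
  set y := F x with hydef
  have happ : ∀ q ∈ (τ y).baseSet, ∀ v : TangentSpace (𝓡 2) q,
      (τ y ⟨q, v⟩).2 = (τ y).continuousLinearMapAt ℝ q v := fun q hq v => by
    rw [Trivialization.continuousLinearMapAt_apply, Trivialization.coe_linearMapAt_of_mem _ hq]
  -- the derivative of `F` in coordinates
  let G : M × 𝔼 → TangentBundle (𝓡 2) M := fun z =>
    tangentMap (𝓡 2) (𝓡 2) F ⟨z.1, (τ x).symmL ℝ z.1 z.2⟩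
  have hG : ContinuousAt G (x, u) :=
    (hF.continuous_tangentMap le_rfl).continuousAt.comp (continuousAt_mk_symmL hx u)
  have hG2 : ContinuousAt (fun z => τ y (G z)) (x, u) :=
    ((τ y).toOpenPartialHomeomorph.continuousAt ((τ y).mem_source.2 hyb)).comp hG
  set w : TangentSpace (𝓡 2) y := mfderiv (𝓡 2) (𝓡 2) F x ((τ x).symmL ℝ x u) with hw
  have hw0 : w ≠ 0 := fun h0 => hu0 (by
    have := hker _ hu h0
    rw [← Trivialization.continuousLinearMapAt_symmL (R := ℝ) (τ x) hxb u, this, map_zero])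
  have hwint : w ∈ interior (C y) := (hinv _ hu).resolve_left hw0
  have hval : τ y (G (x, u)) = (y, (τ y).continuousLinearMapAt ℝ y w) := by
    refine Prod.ext ?_ (happ y hyb w)
    exact (τ y).coe_fst ((τ y).mem_source.2 hyb)
  have hback : (τ y).symmL ℝ y ((τ y).continuousLinearMapAt ℝ y w) = w :=
    Trivialization.symmL_continuousLinearMapAt _ hyb w
  have hint : (τ y).continuousLinearMapAt ℝ y w ∈ interior (coneIn C y y) := by
    refine mem_interior.2 ⟨(τ y).symmL ℝ y ⁻¹' interior (C y), preimage_mono interior_subset,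
      isOpen_interior.preimage ((τ y).symmL ℝ y).continuous, ?_⟩
    rw [mem_preimage, hback]
    exact hwint
  have hne : (τ y).continuousLinearMapAt ℝ y w ≠ 0 := fun h0 => hw0 (by
    rw [← hback, h0, map_zero])
  have hev : ∀ᶠ q in 𝓝 (y, (τ y).continuousLinearMapAt ℝ y w),
      q.2 ∈ coneIn C y q.1 ∨ -q.2 ∈ coneIn C y q.1 := by
    refine eventually_mem_cone ?_ (fun v hv => eventually_notMem_coneIn hC hy hv)
      (fun v hv N hN => eventually_exists_mem_coneIn hC hy hv hN) hint hne
    filter_upwards [(chartAt 𝔼 y).open_source.mem_nhds hy] with q hq using isCone_coneIn hC hq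
  have hne' : ∀ᶠ q : M × 𝔼 in 𝓝 (y, (τ y).continuousLinearMapAt ℝ y w), q.2 ≠ 0 :=
    (isOpen_ne.preimage continuous_snd).mem_nhds hne
  have hGt : Tendsto (fun z => τ y (G z)) (𝓝 (x, u))
      (𝓝 (y, (τ y).continuousLinearMapAt ℝ y w)) := hval ▸ hG2.tendsto
  have hbase : ∀ᶠ z : M × 𝔼 in 𝓝 (x, u), F z.1 ∈ (τ y).baseSet :=
    (hF.continuous.comp continuous_fst).continuousAt.eventually
      ((τ y).open_baseSet.mem_nhds hyb)
  filter_upwards [hGt.eventually hev, hGt.eventually hne', hbase] with z h1 h2 h3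
  have hz2 : (τ y (G z)).2 = (τ y).continuousLinearMapAt ℝ (F z.1)
      (mfderiv (𝓡 2) (𝓡 2) F z.1 ((τ x).symmL ℝ z.1 z.2)) := happ _ h3 _
  have hz1 : (τ y (G z)).1 = F z.1 := (τ y).coe_fst ((τ y).mem_source.2 h3)
  rw [hz1, hz2] at h1
  rw [hz2] at h2
  refine ⟨fun h0 => h2 (by rw [h0, map_zero]), ?_⟩
  simp only [coneIn, mem_preimage, map_neg] at h1
  rwa [Trivialization.symmL_continuousLinearMapAt _ h3] at h1

/-- At every point there are linear coordinates in which, at all nearby points, the cone field is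
contained in the horizontal cone of slope `θ < 1`, while the horizontal cone of slope `1` is mapped
into the two-sided cone field by the derivative of `F`. -/
lemma exists_adapted_coordinates (hC : IsContinuousConeField C)
    (hF : ContMDiff (𝓡 2) (𝓡 2) 1 F)
    (hinv : ∀ v ∈ C x, mfderiv (𝓡 2) (𝓡 2) F x v ∈ insert 0 (interior (C (F x))))
    (hker : ∀ v ∈ C x, mfderiv (𝓡 2) (𝓡 2) F x v = 0 → v = 0) :
    ∃ L : 𝔼 ≃L[ℝ] ℝ × ℝ, ∃ θ : ℝ, 0 < θ ∧ θ < 1 ∧ ∀ᶠ p in 𝓝 x,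
      (∀ u ∈ coneIn C x p, u ≠ 0 → |(L u).2| < θ * |(L u).1|) ∧
      ∀ u, u ≠ 0 → |(L u).2| ≤ |(L u).1| →
        mfderiv (𝓡 2) (𝓡 2) F p ((τ x).symmL ℝ p u) ≠ 0 ∧
        (mfderiv (𝓡 2) (𝓡 2) F p ((τ x).symmL ℝ p u) ∈ C (F p) ∨
          -mfderiv (𝓡 2) (𝓡 2) F p ((τ x).symmL ℝ p u) ∈ C (F p)) := by
  have hx : x ∈ (chartAt 𝔼 x).source := mem_chart_source _ x
  have hcone : ∀ᶠ p in 𝓝 x, IsCone (coneIn C x p) := by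
    filter_upwards [(chartAt 𝔼 x).open_source.mem_nhds hx] with q hq using isCone_coneIn hC hq
  obtain ⟨L, h, hh, hL⟩ := (isCone_coneIn hC hx).exists_coordinates
  let Q : M × 𝔼 → Prop := fun z => mfderiv (𝓡 2) (𝓡 2) F z.1 ((τ x).symmL ℝ z.1 z.2) ≠ 0 ∧
      (mfderiv (𝓡 2) (𝓡 2) F z.1 ((τ x).symmL ℝ z.1 z.2) ∈ C (F z.1) ∨
        -mfderiv (𝓡 2) (𝓡 2) F z.1 ((τ x).symmL ℝ z.1 z.2) ∈ C (F z.1))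
  have hQneg : ∀ (p : M) (u : 𝔼), Q (p, -u) → Q (p, u) := by
    rintro p u ⟨h1, h2⟩
    simp only [map_neg, neg_neg] at h1 h2
    exact ⟨neg_ne_zero.1 h1, h2.symm⟩
  have hQ : ∀ u : 𝔼, u ≠ 0 → |(L u).2| ≤ h * |(L u).1| → ∀ᶠ z in 𝓝 (x, u), Q z := by
    intro u hu0 hu
    rcases (hL u).2 hu with hu | hu
    · exact eventually_mfderiv_mem_cone hC hF hinv hker hu hu0
    · have hc : Continuous fun z : M × 𝔼 => (z.1, -z.2) := by fun_prop
      filter_upwards [(hc.tendsto (x, u)).eventually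
        (eventually_mfderiv_mem_cone hC hF hinv hker hu (neg_ne_zero.2 hu0))] with z hz
      exact hQneg _ _ hz
  -- the width `η` by which the cone at `x` may be enlarged, and the neighbourhood of `x`
  have hsphere : ∀ᶠ s : ℝ × M in 𝓝 (0, x), ∀ u ∈ Metric.sphere (0 : 𝔼) 1,
      |(L u).2| ≤ (h + 2 * s.1) * |(L u).1| → Q (s.2, u) := by
    refine (isCompact_sphere _ _).eventually_forall_of_forall_eventually fun u hu => ?_
    have hu0 : u ≠ 0 := by
      rintro rfl
      simp at hu
    by_cases hle : |(L u).2| ≤ h * |(L u).1|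
    · have hc : Continuous fun z : (ℝ × M) × 𝔼 => (z.1.2, z.2) := by fun_prop
      filter_upwards [(hc.tendsto ((0, x), u)).eventually (hQ u hu0 hle)] with z hz _ using hz
    · have hc1 : Continuous fun z : (ℝ × M) × 𝔼 => (h + 2 * z.1.1) * |(L z.2).1| := by fun_prop
      have hc2 : Continuous fun z : (ℝ × M) × 𝔼 => |(L z.2).2| := by fun_prop
      filter_upwards [(isOpen_lt hc1 hc2).mem_nhds (x := ((0, x), u))
        (by simpa using hle)] with z hz hz' using absurd hz' (not_le.2 hz)
  rw [nhds_prod_eq] at hsphere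
  obtain ⟨η, hη, hη0⟩ := ((hsphere.curry.filter_mono (nhdsWithin_le_nhds (s := Ioi (0 : ℝ)))).and
    self_mem_nhdsWithin).exists
  replace hη0 : 0 < η := hη0
  have hpos : 0 < h + 2 * η := by positivity
  have hsub := eventually_cone_subset hcone (fun u hu => eventually_notMem_coneIn hC hx hu)
    (show h < h + η by linarith) (fun v hv => (hL v).1 (Or.inl hv))
  -- rescale the second coordinate
  let L' : 𝔼 ≃L[ℝ] ℝ × ℝ := L.trans ((ContinuousLinearEquiv.refl ℝ ℝ).prodCongr
    (ContinuousLinearEquiv.unitsEquivAut ℝ (Units.mk0 (h + 2 * η)⁻¹ (inv_ne_zero hpos.ne'))))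
  have hL1 : ∀ u, (L' u).1 = (L u).1 := fun u => rfl
  have hL2 : ∀ u, |(L' u).2| = |(L u).2| / (h + 2 * η) := fun u => by
    change |(L u).2 * (h + 2 * η)⁻¹| = _
    rw [← div_eq_mul_inv, abs_div, abs_of_pos hpos]
  refine ⟨L', (h + η) / (h + 2 * η), by positivity, (div_lt_one hpos).2 (by linarith), ?_⟩
  filter_upwards [hη, hsub] with p h1 h2
  refine ⟨fun u hu hu0 => ?_, fun u hu0 hu => ?_⟩
  · rw [hL1, hL2, div_mul_eq_mul_div]
    exact div_lt_div_of_pos_right (h2 u hu hu0) hpos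
  · rw [hL1, hL2, div_le_iff₀ hpos, mul_comm] at hu
    have hn : 0 < ‖u‖⁻¹ := inv_pos.2 (norm_pos_iff.2 hu0)
    obtain ⟨h3, h4⟩ := h1 (‖u‖⁻¹ • u) (by simp [norm_smul, hu0]) (by
      rw [map_smul, Prod.smul_fst, Prod.smul_snd, smul_eq_mul, smul_eq_mul, abs_mul, abs_mul,
        mul_left_comm]
      exact mul_le_mul_of_nonneg_left hu (abs_nonneg _))
    have hback : mfderiv (𝓡 2) (𝓡 2) F p ((τ x).symmL ℝ p u) =
        ‖u‖ • mfderiv (𝓡 2) (𝓡 2) F p ((τ x).symmL ℝ p (‖u‖⁻¹ • u)) := by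
      rw [← map_smul, ← map_smul, smul_inv_smul₀ (norm_ne_zero_iff.2 hu0)]
    refine ⟨fun h0 => h3 ?_, ?_⟩
    · rw [hback] at h0
      exact (smul_eq_zero.1 h0).resolve_left (norm_ne_zero_iff.2 hu0)
    · rw [hback, ← smul_neg]
      exact h4.imp ((hC.isCone _).smul_mem (norm_nonneg u)) ((hC.isCone _).smul_mem (norm_nonneg u))

end AdaptedCharts

/-! ### Finite adapted atlases, and chords of u-arcs -/

section SurfaceAtlas

/-- The Euclidean plane. -/
local notation "𝔼" => EuclideanSpace ℝ (Fin 2)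

/-- A chart adapted to a cone field `C` and to a map `F`: over the square of half-side `2`, the cone
field is contained in the horizontal cone of slope `θ`, and the derivative of `F` sends the
horizontal cone of slope `1` into the two-sided cone field. -/
structure IsAdaptedChart {M : Type*} [TopologicalSpace M]
    [ChartedSpace (EuclideanSpace ℝ (Fin 2)) M] (F : M → M)
    (C : ∀ x : M, Set (TangentSpace (𝓡 2) x)) (e : OpenPartialHomeomorph M (ℝ × ℝ)) (θ : ℝ) :
    Prop where
  mdifferentiableAt : ∀ p ∈ e.source, MDifferentiableAt (𝓡 2) 𝓘(ℝ, ℝ × ℝ) e p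
  mdifferentiableAt_symm : ∀ z ∈ e.target, MDifferentiableAt 𝓘(ℝ, ℝ × ℝ) (𝓡 2) e.symm z
  closedBall_subset : Metric.closedBall 0 2 ⊆ e.target
  cone : ∀ p ∈ e.source, e p ∈ Metric.closedBall 0 2 → ∀ v ∈ C p, v ≠ 0 →
    |(mfderiv (𝓡 2) 𝓘(ℝ, ℝ × ℝ) e p v : ℝ × ℝ).2| <
      θ * |(mfderiv (𝓡 2) 𝓘(ℝ, ℝ × ℝ) e p v : ℝ × ℝ).1|
  image : ∀ p ∈ e.source, e p ∈ Metric.closedBall 0 2 → ∀ v : TangentSpace (𝓡 2) p, v ≠ 0 →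
    |(mfderiv (𝓡 2) 𝓘(ℝ, ℝ × ℝ) e p v : ℝ × ℝ).2| ≤
      |(mfderiv (𝓡 2) 𝓘(ℝ, ℝ × ℝ) e p v : ℝ × ℝ).1| →
    mfderiv (𝓡 2) (𝓡 2) F p v ≠ 0 ∧
      (mfderiv (𝓡 2) (𝓡 2) F p v ∈ C (F p) ∨ -mfderiv (𝓡 2) (𝓡 2) F p v ∈ C (F p))

section Topological

variable {M : Type*} [TopologicalSpace M] [ChartedSpace (EuclideanSpace ℝ (Fin 2)) M]
  {C : ∀ x : M, Set (TangentSpace (𝓡 2) x)} {F : M → M}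

lemma IsAdaptedChart.mono {e : OpenPartialHomeomorph M (ℝ × ℝ)} {θ θ' : ℝ}
    (h : IsAdaptedChart F C e θ) (hθ : θ ≤ θ') : IsAdaptedChart F C e θ' where
  mdifferentiableAt := h.mdifferentiableAt
  mdifferentiableAt_symm := h.mdifferentiableAt_symm
  closedBall_subset := h.closedBall_subset
  cone p hp hp' v hv hv0 := (h.cone p hp hp' v hv hv0).trans_le
    (mul_le_mul_of_nonneg_right hθ (abs_nonneg _))
  image := h.image

variable [IsManifold (𝓡 2) 1 M]

/-- Every point is the centre of an adapted chart. -/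
lemma exists_isAdaptedChart (hC : IsContinuousConeField C) (hF : ContMDiff (𝓡 2) (𝓡 2) 1 F)
    {x : M} (hinv : ∀ v ∈ C x, mfderiv (𝓡 2) (𝓡 2) F x v ∈ insert 0 (interior (C (F x))))
    (hker : ∀ v ∈ C x, mfderiv (𝓡 2) (𝓡 2) F x v = 0 → v = 0) :
    ∃ (e : OpenPartialHomeomorph M (ℝ × ℝ)) (θ : ℝ), 0 < θ ∧ θ < 1 ∧ x ∈ e.source ∧ e x = 0 ∧
      IsAdaptedChart F C e θ := by
  obtain ⟨L, θ, hθ, hθ1, hL⟩ := exists_adapted_coordinates hC hF hinv hker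
  set φ := chartAt 𝔼 x with hφ
  have hx : x ∈ φ.source := mem_chart_source _ x
  -- the scale at which the conditions hold
  have hnear : ∀ᶠ z : ℝ × ℝ in 𝓝 0, L.symm z + φ x ∈ φ.target ∧
      (∀ u ∈ coneIn C x (φ.symm (L.symm z + φ x)), u ≠ 0 → |(L u).2| < θ * |(L u).1|) ∧
      ∀ u, u ≠ 0 → |(L u).2| ≤ |(L u).1| →
        mfderiv (𝓡 2) (𝓡 2) F (φ.symm (L.symm z + φ x))
          ((trivializationAt 𝔼 (TangentSpace (𝓡 2)) x).symmL ℝ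
            (φ.symm (L.symm z + φ x)) u) ≠ 0 ∧
        (mfderiv (𝓡 2) (𝓡 2) F (φ.symm (L.symm z + φ x))
          ((trivializationAt 𝔼 (TangentSpace (𝓡 2)) x).symmL ℝ
            (φ.symm (L.symm z + φ x)) u) ∈ C (F (φ.symm (L.symm z + φ x))) ∨
        -mfderiv (𝓡 2) (𝓡 2) F (φ.symm (L.symm z + φ x))
          ((trivializationAt 𝔼 (TangentSpace (𝓡 2)) x).symmL ℝ
            (φ.symm (L.symm z + φ x)) u) ∈ C (F (φ.symm (L.symm z + φ x)))) := by
    have hc : Tendsto (fun z : ℝ × ℝ => L.symm z + φ x) (𝓝 0) (𝓝 (φ x)) := by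
      have : Continuous fun z : ℝ × ℝ => L.symm z + φ x := by fun_prop
      simpa using this.tendsto 0
    have hc' := (φ.continuousAt_symm (φ.map_source hx)).tendsto.comp hc
    rw [φ.left_inv hx] at hc'
    exact (hc.eventually (φ.open_target.mem_nhds (φ.map_source hx))).and (hc'.eventually hL)
  obtain ⟨r, hr, hball⟩ := Metric.nhds_basis_closedBall.eventually_iff.1 hnear
  have hR : (2 / r : ℝ) ≠ 0 := by positivity
  let A : 𝔼 ≃ₜ ℝ × ℝ := (Homeomorph.subRight (φ x)).trans
    (L.toHomeomorph.trans (Homeomorph.smulOfNeZero (2 / r) hR))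
  have hA : ∀ w, A w = (2 / r) • L (w - φ x) := fun w => rfl
  have hA' : ∀ z, A.symm z = L.symm ((2 / r)⁻¹ • z) + φ x := fun z => rfl
  have hscale : ∀ z ∈ Metric.closedBall (0 : ℝ × ℝ) 2,
      (2 / r : ℝ)⁻¹ • z ∈ Metric.closedBall (0 : ℝ × ℝ) r := fun z hz => by
    rw [mem_closedBall_zero_iff] at hz ⊢
    rw [norm_smul, norm_inv, Real.norm_of_nonneg (by positivity)]
    calc (2 / r)⁻¹ * ‖z‖ ≤ (2 / r)⁻¹ * 2 := by gcongr
      _ = r := by field_simp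
  let e := φ.transHomeomorph A
  have hsource : e.source = φ.source := rfl
  have hsymm : ∀ z, e.symm z = φ.symm (L.symm ((2 / r : ℝ)⁻¹ • z) + φ x) := fun z => rfl
  have htarget : ∀ z, z ∈ e.target ↔ L.symm ((2 / r : ℝ)⁻¹ • z) + φ x ∈ φ.target := fun z => Iff.rfl
  have hAd : ∀ w, HasFDerivAt A ((2 / r : ℝ) • (L : 𝔼 →L[ℝ] ℝ × ℝ)) w := fun w =>
    ((L : 𝔼 →L[ℝ] ℝ × ℝ).hasFDerivAt.comp w ((hasFDerivAt_id w).sub_const (φ x))).const_smul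
      (2 / r : ℝ)
  have hed : ∀ p ∈ e.source, HasMFDerivAt (𝓡 2) 𝓘(ℝ, ℝ × ℝ) e p
      (((2 / r : ℝ) • (L : 𝔼 →L[ℝ] ℝ × ℝ)).comp
        (mfderiv (𝓡 2) 𝓘(ℝ, 𝔼) (extChartAt (𝓡 2) x) p)) := fun p hp =>
    (hAd _).hasMFDerivAt.comp p (mdifferentiableAt_extChartAt hp).hasMFDerivAt
  have hval : ∀ p ∈ e.source, ∀ v : TangentSpace (𝓡 2) p,
      (mfderiv (𝓡 2) 𝓘(ℝ, ℝ × ℝ) e p v : ℝ × ℝ) = (2 / r : ℝ) •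
        L ((trivializationAt 𝔼 (TangentSpace (𝓡 2)) x).continuousLinearMapAt ℝ p v) := by
    intro p hp v
    rw [(hed p hp).mfderiv, TangentBundle.continuousLinearMapAt_trivializationAt hp]
    rfl
  have hrpos : 0 < |2 / r| := abs_pos.2 hR
  have hcoord : ∀ p ∈ e.source, e p ∈ Metric.closedBall 0 2 →
      (2 / r : ℝ)⁻¹ • e p ∈ Metric.closedBall (0 : ℝ × ℝ) r ∧
      φ.symm (L.symm ((2 / r : ℝ)⁻¹ • e p) + φ x) = p := fun p hp hp' => by
    refine ⟨hscale _ hp', ?_⟩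
    rw [← hsymm, e.left_inv hp]
  refine ⟨e, θ, hθ, hθ1, hx, ?_, ?_, ?_, ?_, ?_, ?_⟩
  · change A (φ x) = 0
    rw [hA, sub_self, map_zero, smul_zero]
  · exact fun p hp => (hed p hp).mdifferentiableAt
  · intro z hz
    have h1 : MDifferentiableAt (𝓡 2) (𝓡 2) φ.symm (A.symm z) :=
      (mdifferentiable_chart x).mdifferentiableAt_symm hz
    have h2 : DifferentiableAt ℝ A.symm z := by
      change DifferentiableAt ℝ (fun z => L.symm ((2 / r : ℝ)⁻¹ • z) + φ x) z
      fun_prop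
    exact h1.comp z h2.mdifferentiableAt
  · exact fun z hz => (htarget z).2 (hball (hscale z hz)).1
  · intro p hp hp' v hv hv0
    obtain ⟨hc1, hc2⟩ := hcoord p hp hp'
    obtain ⟨-, h1, -⟩ := hball hc1
    rw [hc2] at h1
    have hback := Trivialization.symmL_continuousLinearMapAt (R := ℝ)
      (trivializationAt 𝔼 (TangentSpace (𝓡 2)) x) (mem_trivializationAt_baseSet hp) v
    have h2 := h1 ((trivializationAt 𝔼 (TangentSpace (𝓡 2)) x).continuousLinearMapAt ℝ p v)
      (by rwa [coneIn, mem_preimage, hback]) (fun h0 => hv0 (by rw [← hback, h0, map_zero]))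
    rw [hval p hp, Prod.smul_fst, Prod.smul_snd, smul_eq_mul, smul_eq_mul, abs_mul, abs_mul,
      mul_left_comm]
    exact mul_lt_mul_of_pos_left h2 hrpos
  · intro p hp hp' v hv0 hv
    obtain ⟨hc1, hc2⟩ := hcoord p hp hp'
    obtain ⟨-, -, h1⟩ := hball hc1
    rw [hc2] at h1
    have hback := Trivialization.symmL_continuousLinearMapAt (R := ℝ)
      (trivializationAt 𝔼 (TangentSpace (𝓡 2)) x) (mem_trivializationAt_baseSet hp) v
    rw [hval p hp, Prod.smul_fst, Prod.smul_snd, smul_eq_mul, smul_eq_mul, abs_mul, abs_mul] at hv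
    have h2 := h1 ((trivializationAt 𝔼 (TangentSpace (𝓡 2)) x).continuousLinearMapAt ℝ p v)
      (fun h0 => hv0 (by rw [← hback, h0, map_zero])) (le_of_mul_le_mul_left hv hrpos)
    rwa [hback] at h2

/-- In a chart adapted to the cone field, the chords of a u-arc issued from a given point are
eventually in the horizontal cone, since their limit directions are tangent vectors. -/
lemma IsAdaptedChart.chord_of_tangent {e : OpenPartialHomeomorph M (ℝ × ℝ)} {θ : ℝ}
    (h : IsAdaptedChart F C e θ) {γ : ℝ → M} {t : ℝ} (hcont : ContinuousOn γ (Icc 0 1))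
    (hinj : InjOn γ (Icc 0 1)) (ht : t ∈ Icc (0 : ℝ) 1)
    (htan : ∀ v : TangentSpace (𝓡 2) (γ t), IsTangentVector γ t v → v ∈ C (γ t))
    (hsrc : γ t ∈ e.source) (hball : e (γ t) ∈ Metric.closedBall 0 2) :
    ∃ ε > 0, ∀ s ∈ Icc (0 : ℝ) 1, |s - t| < ε →
      |(e (γ s)).2 - (e (γ t)).2| ≤ θ * |(e (γ s)).1 - (e (γ t)).1| := by
  by_contra! hcon
  choose s hs hst hlt using fun n : ℕ => hcon (1 / ((n : ℝ) + 1)) (by positivity)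
  have hslim : Tendsto s atTop (𝓝 t) := by
    refine tendsto_iff_dist_tendsto_zero.2 (squeeze_zero (fun _ => dist_nonneg)
      (fun n => (hst n).le) tendsto_one_div_add_atTop_nhds_zero_nat)
  have hne : ∀ n, s n ≠ t := fun n h0 => by simpa [h0] using hlt n
  have hγlim : Tendsto (fun n => γ (s n)) atTop (𝓝 (γ t)) :=
    (hcont t ht).tendsto.comp (tendsto_nhdsWithin_iff.2 ⟨hslim, Eventually.of_forall hs⟩)
  set φ := extChartAt (𝓡 2) (γ t) with hφ
  have hφsrc : φ.source ∈ 𝓝 (γ t) := extChartAt_source_mem_nhds (γ t)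
  set u : ℕ → 𝔼 := fun n => φ (γ (s n)) - φ (γ t) with hu
  have hulim : Tendsto u atTop (𝓝 0) := by
    have := ((continuousAt_extChartAt (I := 𝓡 2) (γ t)).tendsto.comp hγlim).sub_const (φ (γ t))
    rwa [sub_self] at this
  have hu0 : ∀ᶠ n in atTop, u n ≠ 0 := by
    filter_upwards [hγlim.eventually hφsrc] with n hn h0
    have := φ.injOn hn (mem_extChartAt_source (γ t)) (sub_eq_zero.1 h0)
    exact hne n (hinj (hs n) ht this)
  -- a limit of the normalized chords
  obtain ⟨v, hv, ψ, hψ, hvlim⟩ := (isCompact_closedBall (0 : 𝔼) 1).tendsto_subseq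
    (x := fun n => (‖u n‖⁻¹) • u n) (fun n => by
      rw [mem_closedBall_zero_iff, norm_smul, norm_inv, norm_norm]
      exact inv_mul_le_one)
  have hψt := hψ.tendsto_atTop
  have hvnorm : ‖v‖ = 1 := by
    refine tendsto_nhds_unique (hvlim.norm) (tendsto_const_nhds.congr' ?_)
    filter_upwards [hψt.eventually hu0] with n hn
    rw [comp_apply, norm_smul, norm_inv, norm_norm, inv_mul_cancel₀ (norm_ne_zero_iff.2 hn)]
  -- the chords are oriented so as to have nonnegative multiples of difference quotients
  have hvC : (v : TangentSpace (𝓡 2) (γ t)) ∈ C (γ t) ∨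
      (-v : TangentSpace (𝓡 2) (γ t)) ∈ C (γ t) := by
    have hfreq : (∃ᶠ n in atTop, t < s (ψ n)) ∨ ∃ᶠ n in atTop, s (ψ n) < t := by
      rw [← frequently_or_distrib]
      exact (Eventually.of_forall fun n => (hne (ψ n)).symm.lt_or_gt).frequently
    rcases hfreq with hfreq | hfreq
    · obtain ⟨χ, hχ, hχt⟩ := extraction_of_frequently_atTop hfreq
      refine Or.inl (htan v ⟨fun n => s (ψ (χ n)),
        fun n => ‖u (ψ (χ n))‖⁻¹ * (s (ψ (χ n)) - t), fun n => ⟨hs _, hne _, ?_⟩,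
        hslim.comp (hψt.comp hχ.tendsto_atTop), ?_⟩)
      · exact mul_nonneg (by positivity) (sub_nonneg.2 (hχt n).le)
      · refine (hvlim.comp hχ.tendsto_atTop).congr fun n => ?_
        simp only [comp_apply]
        rw [mul_div_cancel_right₀ _ (sub_ne_zero.2 (hne _))]
    · obtain ⟨χ, hχ, hχt⟩ := extraction_of_frequently_atTop hfreq
      refine Or.inr (htan (-v) ⟨fun n => s (ψ (χ n)),
        fun n => ‖u (ψ (χ n))‖⁻¹ * (t - s (ψ (χ n))), fun n => ⟨hs _, hne _, ?_⟩,
        hslim.comp (hψt.comp hχ.tendsto_atTop), ?_⟩)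
      · exact mul_nonneg (by positivity) (sub_nonneg.2 (hχt n).le)
      · refine (hvlim.comp hχ.tendsto_atTop).neg.congr fun n => ?_
        simp only [comp_apply]
        rw [← neg_sub (s (ψ (χ n))) t, mul_neg, neg_div,
          mul_div_cancel_right₀ _ (sub_ne_zero.2 (hne _)), neg_smul]
  -- the same limit in the adapted chart
  let B : 𝔼 →L[ℝ] ℝ × ℝ := mfderiv (𝓡 2) 𝓘(ℝ, ℝ × ℝ) e (γ t)
  have hB : HasFDerivAt (fun w : 𝔼 => e (φ.symm w)) B (φ (γ t)) := by
    have h1 : MDifferentiableAt 𝓘(ℝ, 𝔼) (𝓡 2) φ.symm (φ (γ t)) := by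
      have := mdifferentiableWithinAt_extChartAt_symm (I := 𝓡 2)
        (mem_extChartAt_target (I := 𝓡 2) (γ t))
      rwa [ModelWithCorners.range_eq_univ, mdifferentiableWithinAt_univ] at this
    have h2 : mfderiv 𝓘(ℝ, 𝔼) (𝓡 2) φ.symm (φ (γ t)) = ContinuousLinearMap.id ℝ 𝔼 := by
      have := mfderivWithin_range_extChartAt_symm (I := 𝓡 2) (x := γ t)
      rwa [ModelWithCorners.range_eq_univ, mfderivWithin_univ] at this
    have h3 := h1.hasMFDerivAt
    rw [h2] at h3
    have h4 : HasMFDerivAt (𝓡 2) 𝓘(ℝ, ℝ × ℝ) e (φ.symm (φ (γ t)))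
        (mfderiv (𝓡 2) 𝓘(ℝ, ℝ × ℝ) e (γ t)) := by
      rw [φ.left_inv (mem_extChartAt_source (γ t))]
      exact (h.mdifferentiableAt _ hsrc).hasMFDerivAt
    exact (h4.comp _ h3).hasFDerivAt
  have hlim : Tendsto (fun n => ‖u (ψ n)‖⁻¹ • (e (φ.symm (φ (γ t) + u (ψ n))) -
      e (φ.symm (φ (γ t))))) atTop (𝓝 (B v)) :=
    (hasFDerivWithinAt_univ.2 hB).lim (hulim.comp hψt) (by simp) hvlim
  have hlim' : Tendsto (fun n => ‖u (ψ n)‖⁻¹ • (e (γ (s (ψ n))) - e (γ t))) atTop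
      (𝓝 (mfderiv (𝓡 2) 𝓘(ℝ, ℝ × ℝ) e (γ t) v : ℝ × ℝ)) := by
    refine hlim.congr' ?_
    filter_upwards [hψt.eventually (hγlim.eventually hφsrc)] with n hn
    simp only [hu, add_sub_cancel]
    rw [φ.left_inv hn, φ.left_inv (mem_extChartAt_source (γ t))]
  have hge : θ * |(mfderiv (𝓡 2) 𝓘(ℝ, ℝ × ℝ) e (γ t) v : ℝ × ℝ).1| ≤
      |(mfderiv (𝓡 2) 𝓘(ℝ, ℝ × ℝ) e (γ t) v : ℝ × ℝ).2| := by
    refine le_of_tendsto_of_tendsto' (((continuous_fst.tendsto _).comp hlim').abs.const_mul θ)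
      ((continuous_snd.tendsto _).comp hlim').abs fun n => ?_
    simp only [comp_apply, Prod.smul_fst, Prod.smul_snd, Prod.fst_sub, Prod.snd_sub, smul_eq_mul,
      abs_mul]
    rw [mul_left_comm]
    exact mul_le_mul_of_nonneg_left (hlt (ψ n)).le (abs_nonneg _)
  have hv0 : v ≠ 0 := by
    rintro rfl
    simp at hvnorm
  rcases hvC with hvC | hvC
  · exact absurd hge (not_le.2 (h.cone _ hsrc hball v hvC hv0))
  · have := h.cone _ hsrc hball (-v) hvC (neg_ne_zero.2 hv0)
    change |(B (-v)).2| < θ * |(B (-v)).1| at this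
    rw [map_neg, Prod.snd_neg, Prod.fst_neg, abs_neg, abs_neg] at this
    exact absurd hge (not_le.2 this)

end Topological

/-- A family of adapted charts, the cores of which cover the surface, is a cone atlas. -/
lemma isConeAtlas_of_isAdaptedChart {M : Type*} [MetricSpace M]
    [ChartedSpace (EuclideanSpace ℝ (Fin 2)) M] {C : ∀ x : M, Set (TangentSpace (𝓡 2) x)}
    {F : M → M} (hF : MDifferentiable (𝓡 2) (𝓡 2) F) {ι : Type*}
    {e : ι → OpenPartialHomeomorph M (ℝ × ℝ)} {θ : ℝ} (hθ : 0 < θ) (hθ1 : θ < 1)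
    (he : ∀ i, IsAdaptedChart F C (e i) θ) (hcover : ∀ x, ∃ i, x ∈ chartCore (e i)) :
    IsConeAtlas F e θ where
  pos := hθ
  lt_one := hθ1
  closedBall_subset i := (he i).closedBall_subset
  cover := hcover
  mapsCone i l z hz hFz := by
    have hz2 : z ∈ Metric.closedBall (0 : ℝ × ℝ) 2 := Metric.ball_subset_closedBall hz
    have hzt : z ∈ (e i).target := (he i).closedBall_subset hz2
    have hps : (e i).symm z ∈ (e i).source := (e i).map_target hzt
    have hep : e i ((e i).symm z) = z := (e i).right_inv hzt
    have h1 := ((he i).mdifferentiableAt_symm z hzt).hasMFDerivAt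
    have h2 := (hF ((e i).symm z)).hasMFDerivAt
    have h3 := ((he l).mdifferentiableAt _ hFz.1).hasMFDerivAt
    have h4 := ((he i).mdifferentiableAt _ hps).hasMFDerivAt
    have h5 : HasFDerivAt (fun w => e l (F ((e i).symm w))) _ z :=
      ((h3.comp _ h2).comp z h1).hasFDerivAt
    refine ⟨_, h5, fun v hv hcone => ?_⟩
    set v' : TangentSpace (𝓡 2) ((e i).symm z) :=
      mfderiv 𝓘(ℝ, ℝ × ℝ) (𝓡 2) (e i).symm z v with hv'
    -- the derivatives of the chart and of its inverse cancel
    have hback : (mfderiv (𝓡 2) 𝓘(ℝ, ℝ × ℝ) (e i) ((e i).symm z) v' : ℝ × ℝ) = v := by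
      let A : ℝ × ℝ →L[ℝ] ℝ × ℝ := (mfderiv (𝓡 2) 𝓘(ℝ, ℝ × ℝ) (e i) ((e i).symm z)).comp
        (mfderiv 𝓘(ℝ, ℝ × ℝ) (𝓡 2) (e i).symm z)
      have hcomp : HasFDerivAt (fun w => e i ((e i).symm w)) A z := (h4.comp z h1).hasFDerivAt
      have hid : (fun w => e i ((e i).symm w)) =ᶠ[𝓝 z] id := by
        filter_upwards [(e i).open_target.mem_nhds hzt] with w hw using (e i).right_inv hw
      have := hcomp.unique ((hasFDerivAt_id z).congr_of_eventuallyEq hid)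
      exact congrArg (fun A : ℝ × ℝ →L[ℝ] ℝ × ℝ => A v) this
    have hv'0 : v' ≠ 0 := fun h0 => hv (by
      rw [← hback, h0, map_zero]
      rfl)
    obtain ⟨hne, hmem⟩ := (he i).image _ hps (by rwa [hep]) v' hv'0 (by rwa [hback])
    have hball : e l (F ((e i).symm z)) ∈ Metric.closedBall (0 : ℝ × ℝ) 2 :=
      Metric.closedBall_subset_closedBall one_le_two (Metric.ball_subset_closedBall hFz.2)
    set w : TangentSpace (𝓡 2) (F ((e i).symm z)) :=
      mfderiv (𝓡 2) (𝓡 2) F ((e i).symm z) v' with hw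
    let B : TangentSpace (𝓡 2) (F ((e i).symm z)) →L[ℝ] ℝ × ℝ :=
      mfderiv (𝓡 2) 𝓘(ℝ, ℝ × ℝ) (e l) (F ((e i).symm z))
    have hstrict : |(B w).2| < θ * |(B w).1| := by
      rcases hmem with hmem | hmem
      · exact (he l).cone _ hFz.1 hball w hmem hne
      · have : |(B (-w)).2| < θ * |(B (-w)).1| :=
          (he l).cone _ hFz.1 hball (-w) hmem (neg_ne_zero.2 hne)
        rwa [map_neg, Prod.snd_neg, Prod.fst_neg, abs_neg, abs_neg] at this
    change |(B w).2| ≤ θ * |(B w).1| ∧ (B w).1 ≠ 0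
    refine ⟨hstrict.le, fun h0 => ?_⟩
    rw [h0, abs_zero, mul_zero] at hstrict
    exact absurd (abs_nonneg _) (not_le.2 hstrict)

/-- A compact surface with a strictly invariant cone field has a finite atlas of adapted charts. -/
lemma exists_finite_adapted_atlas {M : Type*} [MetricSpace M] [CompactSpace M]
    [ChartedSpace (EuclideanSpace ℝ (Fin 2)) M] [IsManifold (𝓡 2) 1 M]
    {C : ∀ x : M, Set (TangentSpace (𝓡 2) x)} {F : M → M}
    (hC : IsContinuousConeField C) (hF : ContMDiff (𝓡 2) (𝓡 2) 1 F)
    (hinv : ∀ x, ∀ v ∈ C x, mfderiv (𝓡 2) (𝓡 2) F x v ∈ insert 0 (interior (C (F x))))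
    (hker : ∀ x, ∀ v ∈ C x, mfderiv (𝓡 2) (𝓡 2) F x v = 0 → v = 0) :
    ∃ (t : Finset M) (e : t → OpenPartialHomeomorph M (ℝ × ℝ)) (θ : ℝ), IsConeAtlas F e θ ∧
      ∀ i, IsAdaptedChart F C (e i) θ := by
  choose e θ hθ hθ1 hxs hx0 he using fun x => exists_isAdaptedChart hC hF (hinv x) (hker x)
  obtain ⟨t, ht⟩ := CompactSpace.elim_nhds_subcover (fun x => chartCore (e x)) fun x =>
    (isOpen_chartCore (e x)).mem_nhds ⟨hxs x, by simp [hx0 x]⟩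
  -- a common slope for the finitely many charts
  obtain ⟨δ, hδ, hδθ⟩ := exists_pos_forall_of_finite (P := fun (i : t) δ => θ i ≤ 1 - δ)
    (fun i δ δ' _ hle h => by linarith) (fun i => ⟨1 - θ i, sub_pos.2 (hθ1 i), by linarith⟩)
  have he' : ∀ i : t, IsAdaptedChart F C (e i) (max (1 - δ) (1 / 2)) := fun i =>
    (he i).mono ((hδθ i).trans (le_max_left _ _))
  refine ⟨t, fun i => e i, max (1 - δ) (1 / 2), isConeAtlas_of_isAdaptedChart
    (hF.mdifferentiable one_ne_zero) (lt_max_of_lt_right (by norm_num))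
    (max_lt (by linarith) (by norm_num)) he' fun x => ?_, he'⟩
  obtain ⟨y, hy, hxy⟩ := mem_iUnion₂.1 (ht.ge (mem_univ x))
  exact ⟨⟨y, hy⟩, hxy⟩

/-- A u-arc contains an arc which is ordered in some chart of an adapted atlas. -/
lemma IsUArc.exists_isOrderedArc {M : Type*} [MetricSpace M]
    [ChartedSpace (EuclideanSpace ℝ (Fin 2)) M] [IsManifold (𝓡 2) 1 M]
    {C : ∀ x : M, Set (TangentSpace (𝓡 2) x)} {F : M → M} {ι : Type*}
    {e : ι → OpenPartialHomeomorph M (ℝ × ℝ)} {θ : ℝ} (h : IsConeAtlas F e θ)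
    (he : ∀ i, IsAdaptedChart F C (e i) θ) {γ : ℝ → M} (hγ : IsUArc C γ) :
    ∃ i, ∃ s t σ : ℝ, 0 ≤ s ∧ s < t ∧ t ≤ 1 ∧ (σ = 1 ∨ σ = -1) ∧
      IsOrderedArc (e i) θ σ γ s t := by
  obtain ⟨K, hK⟩ := hγ.lipschitz
  have hcont : ContinuousOn γ (Icc 0 1) := hK.continuousOn
  obtain ⟨i, hi⟩ := h.cover (γ 0)
  have hnear : ∀ᶠ u in 𝓝[≥] (0 : ℝ), γ u ∈ chartCore (e i) := by
    have := (hcont 0 (left_mem_Icc.2 zero_le_one)).tendsto.eventually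
      ((isOpen_chartCore (e i)).mem_nhds hi)
    rwa [nhdsWithin_Icc_eq_nhdsGE zero_lt_one] at this
  obtain ⟨b, hb, hsub⟩ := mem_nhdsGE_iff_exists_Icc_subset.1 hnear
  replace hb : 0 < b := hb
  have hb1 : Icc 0 (min b 1) ⊆ Icc (0 : ℝ) 1 := Icc_subset_Icc le_rfl (min_le_right _ _)
  have hcore : ∀ u ∈ Icc 0 (min b 1), γ u ∈ chartCore (e i) := fun u hu =>
    hsub ⟨hu.1, hu.2.trans (min_le_left _ _)⟩
  obtain ⟨s, t, σ, h1, h2, h3, hσ, harc⟩ := _root_.exists_isOrderedArc (θ := θ)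
    (lt_min hb one_pos)
    (hcont.mono hb1) (hγ.injOn.mono hb1) hcore fun u hu => by
      obtain ⟨ε, hε, H⟩ := (he i).chord_of_tangent hcont hγ.injOn (hb1 hu)
        (hγ.tangent u (hb1 hu)) (hcore u hu).1
        (Metric.closedBall_subset_closedBall one_le_two
          (Metric.ball_subset_closedBall (hcore u hu).2))
      exact ⟨ε, hε, fun v hv huv => H v (hb1 hv) huv⟩
  exact ⟨i, s, t, σ, h1, h2, h3.trans (min_le_right _ _), hσ, harc⟩

/-- A surface has no isolated points. -/
lemma neBot_nhdsNE_of_chartedSpace {M : Type*} [TopologicalSpace M]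
    [ChartedSpace (EuclideanSpace ℝ (Fin 2)) M] (x : M) : (𝓝[≠] x).NeBot := by
  set φ := chartAt (EuclideanSpace ℝ (Fin 2)) x with hφ
  have hx : x ∈ φ.source := mem_chart_source _ x
  rw [← mem_closure_iff_nhdsWithin_neBot, mem_closure_iff_nhds]
  intro U hU
  have h1 : φ.symm ⁻¹' U ∩ φ.target ∈ 𝓝 (φ x) := inter_mem
    (φ.continuousAt_symm (φ.map_source hx) (by rwa [φ.left_inv hx]))
    (φ.open_target.mem_nhds (φ.map_source hx))
  obtain ⟨z, ⟨hz1, hz2⟩, hz⟩ := mem_closure_iff_nhds.1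
    (mem_closure_iff_nhdsWithin_neBot.2 (Module.punctured_nhds_neBot ℝ _ (φ x))) _ h1
  refine ⟨φ.symm z, hz1, fun h0 => hz ?_⟩
  rw [mem_singleton_iff] at h0 ⊢
  rw [← h0, φ.right_inv hz2]

end SurfaceAtlas

theorem mainTheorem12 {M : Type*} [MetricSpace M] [CompactSpace M] [ConnectedSpace M]
    [ChartedSpace (EuclideanSpace ℝ (Fin 2)) M] [IsManifold (𝓡 2) ∞ M]
    [RiemannianBundle (fun x : M => TangentSpace (𝓡 2) x)]
    [IsContMDiffRiemannianBundle (𝓡 2) ∞ (EuclideanSpace ℝ (Fin 2))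
      (fun x : M => TangentSpace (𝓡 2) x)]
    [IsRiemannianManifold (𝓡 2) M]
    (f : M → M) (hf : ContMDiff (𝓡 2) (𝓡 2) 1 f) (htrans : IsTransitiveMap f)
    (C : ∀ x : M, Set (TangentSpace (𝓡 2) x)) (hC : IsDominatedSplitting f C) :
    ∃ r : ℝ, 1 < r ∧ ∀ γ : ℝ → M, IsUArc C γ →
      ∃ c : ℝ, 0 < c ∧ ∀ n : ℕ, ENNReal.ofReal (c * r ^ n) ≤ arcLength (f^[n] ∘ γ) := by
  obtain ⟨k, hk, hinv⟩ := hC.invariant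
  obtain ⟨x₀, hx₀⟩ := htrans
  have hF : ContMDiff (𝓡 2) (𝓡 2) 1 f^[k] := hf.iterate k
  obtain ⟨t, e, θ, hatlas, he⟩ := exists_finite_adapted_atlas hC.isContinuousConeField hF hinv
    fun x v hv h0 => hC.transversal x k hk v hv h0
  have := neBot_nhdsNE_of_chartedSpace x₀
  obtain ⟨r, hr, hgrow⟩ := hatlas.exists_exponential_growth hf.continuous hk
    (hatlas.isSensitive hf.continuous hk hx₀)
  refine ⟨r, hr, fun γ hγ => ?_⟩
  obtain ⟨i, s, t', σ, hs, hst, ht', hσ, harc⟩ := hγ.exists_isOrderedArc hatlas he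
  have hs01 : s ∈ Icc (0 : ℝ) 1 := ⟨hs, hst.le.trans ht'⟩
  have ht01 : t' ∈ Icc (0 : ℝ) 1 := ⟨hs.trans hst.le, ht'⟩
  obtain ⟨c, hc, H⟩ := hgrow i σ hσ γ s t' harc fun heq =>
    hst.ne (hγ.injOn hs01 ht01 heq)
  exact ⟨c, hc, fun n => (H n).trans (eVariationOn.mono _ (Icc_subset_Icc hs ht'))⟩
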